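/- Let $\mathbb F_q$ be a finite field with $q$ elements ($q$ an arbitrary prime power) and let $K=\mathbb F_q(t)$ be the function field of $\mathbb P^1$ over $\mathbb F_q$. Let $D$ be the quaternion algebra over $K$ generated by $Z,F$ with relations $$Z^2=c,\quad F^2=t,\quad FZ=-ZF\qquad\text{if } q \text{ is odd},$$ where $c\in\mathbb F_q$ is a fixed non-square, respectively $$Z^2+Z=c,\quad F^2=t,\quad FZ=(Z+1)F\qquad\text{if } q\text{ is even},$$ where $c\in\mathbb F_q$ is fixed such that $X^2+X+c$ is irreducible over $\mathbb F_q$. Let $\mathcal A=\mathcal O\oplus\mathcal O Z\oplus\mathcal O(-\infty)F\oplus\mathcal O(-\infty)FZ$, a sheaf of orders in $D$ over $\mathbb P^1$. Let $S$ be a finite set of places of $K$ (closed points of $\mathbb P^1$, not necessarily rational) with $\{0,\infty\}\subseteq S$, put $S_0=S\setminus\{0,\infty\}$, let $\mathfrak o_{K,S}=\Gamma(\mathbb P^1\setminus S,\mathcal O)$ be the ring of $S$-integers, and let $$\Lambda_S=\mathcal A(\mathbb P^1\setminus S)^\times/\mathfrak o_{K,S}^\times .$$ For every $v\in S_0$ the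 algebra $D\otimes_K K_v$ over the completion $K_v$ is isomorphic to $M_2(K_v)$. Fix any such isomorphisms of $K_v$-algebras, and let $\Lambda_S$ act through them on the vertices of $\prod_{v\in S_0}T_v$, where $T_v$ is the Bruhat--Tits tree of $\mathrm{PGL}_2(K_v)$, whose vertices are the homothety classes of lattices in $K_v^2$ over the valuation ring of $K_v$. Then this action has finitely many vertex orbits and finite vertex stabilisers, and the orbifold degree $$N_0(\Lambda_S)=\sum_{P}\frac1{\#\Lambda_P},$$ where $P$ runs through the vertices of $\Lambda_S\backslash\prod_{v\in S_0}T_v$ (the orbits of vertices) and $\Lambda_P$ is the stabiliser in $\Lambda_S$ of a representative of $P$, equals $$N_0(\Lambda_S)=\frac{1}{2(q+1)}.$$ -/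

import Mathlib

open Polynomial IsDedekindDomain
open scoped TensorProduct WithZero ENNReal

noncomputable section

namespace QuatLattice

/-! ### Vertices of the Bruhat-Tits tree of `PGL₂(K)` -/

section Building

variable (O : Type*) [CommRing O] (K : Type*) [Field K] [Algebra O K]

/-- The `O`-lattices in `K²`: finitely generated `O`-submodules spanning `K²` over `K`. -/
def Lattice : Type _ := {L : Submodule O (Fin 2 → K) // L.IsLattice K}

variable {O K}

/-- The image `g L` of an `O`-submodule `L` of `K²` under a matrix `g`. -/
def translate (g : Matrix (Fin 2) (Fin 2) K) (L : Submodule O (Fin 2 → K)) :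
    Submodule O (Fin 2 → K) :=
  L.map ((Matrix.toLin' g).restrictScalars O)

theorem translate_one (L : Submodule O (Fin 2 → K)) : translate 1 L = L := by
  ext x; simp [translate]

theorem translate_mul (g h : Matrix (Fin 2) (Fin 2) K) (L : Submodule O (Fin 2 → K)) :
    translate (g * h) L = translate g (translate h L) := by
  ext x; simp [translate]

theorem isLattice_translate (g : GL (Fin 2) K) (L : Submodule O (Fin 2 → K))
    (hL : L.IsLattice K) : (translate g.1 L).IsLattice K where
  fg := hL.fg.map _
  span_eq_top := by
    have h1 : ((translate g.1 L : Submodule O (Fin 2 → K)) : Set (Fin 2 → K))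
        = Matrix.toLin' g.1 '' (L : Set (Fin 2 → K)) := rfl
    rw [h1, ← Submodule.map_span, hL.span_eq_top, Submodule.map_top, LinearMap.range_eq_top]
    intro y
    refine ⟨Matrix.toLin' (g⁻¹).1 y, ?_⟩
    rw [← LinearMap.comp_apply, ← Matrix.toLin'_mul, Units.mul_inv]
    simp

/-- `GL₂(K)` acts on lattices by `(g, L) ↦ g L`. -/
instance : MulAction (GL (Fin 2) K) (Lattice O K) where
  smul g L := ⟨translate g.1 L.1, isLattice_translate g L.1 L.2⟩
  one_smul L := Subtype.ext (translate_one L.1)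
  mul_smul g h L := Subtype.ext (translate_mul g.1 h.1 L.1)

/-- The scalar matrix attached to a nonzero scalar. -/
def scalarGL : Kˣ →* GL (Fin 2) K :=
  Units.map (Matrix.scalar (Fin 2)).toMonoidHom

theorem scalarGL_comm (u : Kˣ) (g : GL (Fin 2) K) : scalarGL u * g = g * scalarGL u := by
  apply Units.ext
  exact (Matrix.scalar_commute (n := Fin 2) (u : K) (fun r => mul_comm _ _) g.1).eq

variable (O K)

/-- Two lattices are homothetic if they differ by a nonzero scalar. -/
def homothety : Setoid (Lattice O K) where
  r L M := ∃ u : Kˣ, scalarGL u • L = M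
  iseqv :=
    { refl := fun L => ⟨1, by simp⟩
      symm := by
        rintro L M ⟨u, rfl⟩
        exact ⟨u⁻¹, by rw [smul_smul, ← map_mul]; simp⟩
      trans := by
        rintro L M N ⟨u, rfl⟩ ⟨w, rfl⟩
        exact ⟨w * u, by rw [smul_smul, ← map_mul]⟩ }

/-- The vertices of the Bruhat-Tits tree of `PGL₂(K)`, where `K` is a complete discretely valued
field with valuation ring `O`: homothety classes of lattices in `K²`. -/
def TreeVertex : Type _ := Quotient (homothety O K)

variable {O K}

/-- `GL₂(K)` acts on the vertices of the tree by `(g, [L]) ↦ [g L]`. -/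
instance : MulAction (GL (Fin 2) K) (TreeVertex O K) where
  smul g := Quotient.map (g • ·) (by
    rintro L M ⟨u, rfl⟩
    exact ⟨u, by simp only [smul_smul, scalarGL_comm]⟩)
  one_smul x := by
    induction x using Quotient.inductionOn with
    | h L => exact congrArg (Quotient.mk _) (one_smul _ L)
  mul_smul g h x := by
    induction x using Quotient.inductionOn with
    | h L => exact congrArg (Quotient.mk _) (mul_smul g h L)

/-- Scalar matrices fix every vertex, so that the action factors through `PGL₂(K)`. -/
theorem scalarGL_smul_treeVertex (u : Kˣ) (x : TreeVertex O K) : scalarGL u • x = x := by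
  induction x using Quotient.inductionOn with
  | h L => exact Quotient.sound ((homothety O K).symm ⟨u, rfl⟩)

end Building

/-! ### Orbifold degree of a group action -/

/-- The sum over the orbits `P` of `1 / #(stabiliser of a representative of P)`, as an extended
nonnegative real number (an infinite stabiliser contributes `0`). -/
def orbifoldDegree (G : Type*) [Group G] (X : Type*) [MulAction G X] : ℝ≥0∞ :=
  ∑' P : MulAction.orbitRel.Quotient G X,
    ((ENat.card (MulAction.stabilizer G P.out) : ℕ∞) : ℝ≥0∞)⁻¹

/-! ### Places of the projective line -/

variable (k : Type*) [Field k]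

/-- The places of `k(t)`: the maximal ideals of `k[t]` and the place at infinity. -/
inductive Place : Type _
  | finite (v : HeightOneSpectrum k[X]) : Place
  | infinity : Place

/-- The place `t = 0`. -/
def Place.zero : Place k := .finite (Polynomial.idealX k)

variable {k}

open Classical in
/-- The valuation of `k(t)` at a place. -/
def Place.valuation : Place k → Valuation (RatFunc k) ℤᵐ⁰
  | .finite v => v.valuation (RatFunc k)
  | .infinity => RatFunc.inftyValuation k

/-- `Γ(ℙ¹ ∖ S, 𝒪)`, the ring of `S`-integers of `k(t)`. -/
def sIntegers (S : Finset (Place k)) : Subring (RatFunc k) where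
  carrier := {x | ∀ v ∉ S, v.valuation x ≤ 1}
  zero_mem' v _ := by simp
  one_mem' v _ := by simp
  add_mem' hx hy v hv := (v.valuation.map_add _ _).trans (max_le (hx v hv) (hy v hv))
  mul_mem' hx hy v hv := by
    rw [map_mul]; exact mul_le_one' (hx v hv) (hy v hv)
  neg_mem' hx v hv := by rw [Valuation.map_neg]; exact hx v hv

/-- `Γ(ℙ¹ ∖ S, 𝒪(-∞))`: the `S`-integers that vanish at infinity unless `∞ ∈ S`. -/
def sIntegersVanishing (S : Finset (Place k)) : AddSubgroup (RatFunc k) where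
  carrier := {x | x ∈ sIntegers S ∧
    (Place.infinity ∉ S → (Place.infinity : Place k).valuation x < 1)}
  zero_mem' := ⟨zero_mem _, fun _ => by simp⟩
  add_mem' hx hy := ⟨add_mem hx.1 hy.1, fun h =>
    (Valuation.map_add _ _ _).trans_lt (max_lt (hx.2 h) (hy.2 h))⟩
  neg_mem' hx := ⟨neg_mem hx.1, fun h => by rw [Valuation.map_neg]; exact hx.2 h⟩

theorem valuation_C_le (v : Place k) (a : k) : v.valuation (RatFunc.C a) ≤ 1 := by
  cases v with
  | finite v =>
    have := v.valuation_le_one (K := RatFunc k) (Polynomial.C a)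
    simpa [Place.valuation] using this
  | infinity =>
    by_cases ha : a = 0
    · simp [ha]
    · classical
      exact (RatFunc.inftyValuation.C k ha).le

theorem C_mem_sIntegers (S : Finset (Place k)) (a : k) : RatFunc.C a ∈ sIntegers S :=
  fun v _ => valuation_C_le v a

theorem mul_mem_vanishing {S : Finset (Place k)} {x y : RatFunc k} (hx : x ∈ sIntegers S)
    (hy : y ∈ sIntegersVanishing S) : x * y ∈ sIntegersVanishing S := by
  refine ⟨mul_mem hx hy.1, fun h => ?_⟩
  rw [map_mul]
  exact (mul_le_of_le_one_left' (hx _ h)).trans_lt (hy.2 h)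

theorem X_mul_mul_mem {S : Finset (Place k)} {x y : RatFunc k} (hx : x ∈ sIntegersVanishing S)
    (hy : y ∈ sIntegersVanishing S) : RatFunc.X * x * y ∈ sIntegers S := by
  intro v hv
  cases v with
  | finite v =>
    have hX : (Place.finite v).valuation (RatFunc.X : RatFunc k) ≤ 1 := by
      have := v.valuation_le_one (K := RatFunc k) (Polynomial.X)
      simpa [Place.valuation] using this
    rw [map_mul, map_mul]
    exact mul_le_one' (mul_le_one' hX (hx.1 _ hv)) (hy.1 _ hv)
  | infinity =>
    have hX : (Place.infinity : Place k).valuation (RatFunc.X : RatFunc k) = WithZero.exp 1 := by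
      simp [Place.valuation]
    rw [map_mul, map_mul, hX]
    refine mul_le_one' ?_ (hy.1 _ hv)
    have h := hx.2 hv
    generalize (Place.infinity : Place k).valuation x = z at h
    induction z using WithZero.expRecOn with
    | zero => simp
    | exp n =>
      rw [← WithZero.exp_add, ← WithZero.exp_zero, WithZero.exp_le_exp]
      rw [← WithZero.exp_zero, WithZero.exp_lt_exp] at h
      omega

/-! ### The quaternion algebra and its sheaf of maximal orders -/

/-- The admissible parameters over a finite field `k` with `q` elements: for odd `q`, `b = 0` and
`c` is a non-square; for even `q`, `b = 1` and `X² + X + c` is irreducible. -/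
def IsAdmissible [Fintype k] (b c : k) : Prop :=
  (Odd (Fintype.card k) ∧ b = 0 ∧ ¬ IsSquare c) ∨
  (Even (Fintype.card k) ∧ b = 1 ∧ Irreducible (X ^ 2 + X + C c : k[X]))

/-- The quaternion algebra over `k(t)` with basis `1, Z = i, F = j, ZF = k` and relations
`Z² = c + bZ`, `F² = t`, `FZ = (b - Z)F`. For admissible parameters these are
`Z² = c, F² = t, FZ = -ZF` if `q` is odd and `Z² + Z = c, F² = t, FZ = (Z + 1)F` if `q` is even. -/
abbrev D (b c : k) : Type _ :=
  QuaternionAlgebra (RatFunc k) (RatFunc.C c) (RatFunc.C b) RatFunc.X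

/-- The sections over `ℙ¹ ∖ S` of the sheaf
`𝒜 = 𝒪 ⊕ 𝒪 Z ⊕ 𝒪(-∞) F ⊕ 𝒪(-∞) FZ`; as `FZ = bF - ZF` with `b` constant, the basis element `FZ`
may be replaced by `ZF`. -/
def orderSections (b c : k) (S : Finset (Place k)) : Subring (D b c) where
  carrier := {w | w.re ∈ sIntegers S ∧ w.imI ∈ sIntegers S ∧
    w.imJ ∈ sIntegersVanishing S ∧ w.imK ∈ sIntegersVanishing S}
  zero_mem' := ⟨zero_mem _, zero_mem _, zero_mem _, zero_mem _⟩
  one_mem' := ⟨one_mem _, zero_mem _, zero_mem _, zero_mem _⟩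
  add_mem' hx hy := ⟨add_mem hx.1 hy.1, add_mem hx.2.1 hy.2.1, add_mem hx.2.2.1 hy.2.2.1,
    add_mem hx.2.2.2 hy.2.2.2⟩
  neg_mem' hx := ⟨neg_mem hx.1, neg_mem hx.2.1, neg_mem hx.2.2.1, neg_mem hx.2.2.2⟩
  mul_mem' {x y} hx hy := by
    obtain ⟨x1, x2, x3, x4⟩ := x
    obtain ⟨y1, y2, y3, y4⟩ := y
    obtain ⟨a1, a2, a3, a4⟩ := hx
    obtain ⟨b1, b2, b3, b4⟩ := hy
    have hc := C_mem_sIntegers S c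
    have hb := C_mem_sIntegers S b
    dsimp only at a1 a2 a3 a4 b1 b2 b3 b4
    rw [QuaternionAlgebra.mk_mul_mk]
    refine ⟨?_, ?_, ?_, ?_⟩ <;> dsimp only
    · have h := add_mem (add_mem (mul_mem a1 b1) (mul_mem (mul_mem hc a2) b2))
        (sub_mem (add_mem (X_mul_mul_mem a3 b3) (mul_mem hb (X_mul_mul_mem a3 b4)))
          (mul_mem hc (X_mul_mul_mem a4 b4)))
      convert h using 1; ring
    · have h := add_mem (add_mem (add_mem (mul_mem a1 b2) (mul_mem a2 b1))
        (mul_mem (mul_mem hb a2) b2)) (sub_mem (X_mul_mul_mem a4 b3) (X_mul_mul_mem a3 b4))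
      convert h using 1; ring
    · have h := add_mem (add_mem (mul_mem_vanishing a1 b3)
        (mul_mem_vanishing (mul_mem hc a2) b4)) (sub_mem (add_mem (mul_mem_vanishing b1 a3)
        (mul_mem_vanishing (mul_mem hb b2) a3)) (mul_mem_vanishing (mul_mem hc b2) a4))
      convert h using 1; ring
    · have h := add_mem (add_mem (mul_mem_vanishing a1 b4) (mul_mem_vanishing a2 b3))
        (sub_mem (add_mem (mul_mem_vanishing (mul_mem hb a2) b4) (mul_mem_vanishing b1 a4))
          (mul_mem_vanishing b2 a3))
      convert h using 1; ring

/-! ### The `S`-arithmetic group -/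

/-- The inclusion of the ring of `S`-integers as scalars. -/
def scalarHom (b c : k) (S : Finset (Place k)) : sIntegers S →+* orderSections b c S :=
  (algebraMap (RatFunc k) (D b c)).restrict (sIntegers S) (orderSections b c S)
    (fun _ hx => ⟨hx, zero_mem _, zero_mem _, zero_mem _⟩)

/-- The subgroup of scalar units. -/
def scalarUnits (b c : k) (S : Finset (Place k)) : Subgroup (orderSections b c S)ˣ :=
  (Units.map (scalarHom b c S).toMonoidHom).range

instance (b c : k) (S : Finset (Place k)) : (scalarUnits b c S).Normal where
  conj_mem := by
    rintro _ ⟨u, rfl⟩ g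
    have h : g * Units.map (scalarHom b c S).toMonoidHom u
        = Units.map (scalarHom b c S).toMonoidHom u * g := by
      apply Units.ext
      apply Subtype.ext
      exact (Algebra.commutes (A := D b c) (u : sIntegers S).1 g.1.1).symm
    rw [h, mul_inv_cancel_right]
    exact ⟨u, rfl⟩

/-- `Λ_S = 𝒜(ℙ¹ ∖ S)ˣ / 𝒪(ℙ¹ ∖ S)ˣ`. -/
abbrev Lambda (b c : k) (S : Finset (Place k)) : Type _ :=
  (orderSections b c S)ˣ ⧸ scalarUnits b c S

/-! ### The action on the product of trees -/

/-- `S₀ = S ∖ {0, ∞}`, as a type of finite places. -/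
abbrev UnramifiedPlace (S : Finset (Place k)) : Type _ :=
  {v : HeightOneSpectrum k[X] // Place.finite v ∈ S ∧ Place.finite v ≠ Place.zero k}

/-- The completion of `k(t)` at a finite place. -/
abbrev Completion (v : HeightOneSpectrum k[X]) : Type _ := v.adicCompletion (RatFunc k)

/-- The localised quaternion algebra `D ⊗ K_v`. -/
abbrev LocalD (b c : k) (v : HeightOneSpectrum k[X]) : Type _ :=
  Completion v ⊗[RatFunc k] D b c

/-- Identifications `D ⊗ K_v ≃ M₂(K_v)` of `K_v`-algebras at the places `v ∈ S₀`. -/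
abbrev Splitting (b c : k) (S : Finset (Place k)) : Type _ :=
  (v : UnramifiedPlace S) → LocalD b c v.1 ≃ₐ[Completion v.1] Matrix (Fin 2) (Fin 2) (Completion v.1)

variable {b c : k} {S : Finset (Place k)}

/-- The localisation `𝒜(ℙ¹ ∖ S)ˣ → Dˣ → (D ⊗ K_v)ˣ ≃ GL₂(K_v)`. -/
def localise (φ : Splitting b c S) (v : UnramifiedPlace S) :
    (orderSections b c S)ˣ →* GL (Fin 2) (Completion v.1) :=
  Units.map (((φ v : LocalD b c v.1 →* Matrix (Fin 2) (Fin 2) (Completion v.1)).comp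
    (Algebra.TensorProduct.includeRight : D b c →ₐ[RatFunc k] LocalD b c v.1)).comp
      (orderSections b c S).subtype.toMonoidHom)

/-- The vertices of the product of trees `∏_{v ∈ S₀} T_v`. The splitting is recorded as it
determines the action. -/
def ProductVertex (_φ : Splitting b c S) : Type _ :=
  (v : UnramifiedPlace S) → TreeVertex (v.1.adicCompletionIntegers (RatFunc k)) (Completion v.1)

/-- The action of `𝒜(ℙ¹ ∖ S)ˣ` on the vertices of the product of trees, factor by factor. -/
def unitsToPerm (φ : Splitting b c S) :
    (orderSections b c S)ˣ →* Equiv.Perm (ProductVertex φ) where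
  toFun g :=
    { toFun := fun x v => localise φ v g • x v
      invFun := fun x v => (localise φ v g)⁻¹ • x v
      left_inv := fun x => by funext v; simp
      right_inv := fun x => by funext v; simp }
  map_one' := by
    ext x; funext v
    change localise φ v 1 • x v = x v
    rw [map_one, one_smul]
  map_mul' g h := by
    ext x; funext v
    change localise φ v (g * h) • x v = localise φ v g • localise φ v h • x v
    rw [map_mul, mul_smul]

theorem unitsToPerm_scalar (φ : Splitting b c S) (g : (orderSections b c S)ˣ)
    (hg : g ∈ scalarUnits b c S) : unitsToPerm φ g = 1 := by
  obtain ⟨u, rfl⟩ := hg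
  ext x
  funext v
  have hu : (algebraMap (RatFunc k) (Completion v.1) u.1.1) ≠ 0 := by
    intro h0
    have h1 : (u.1.1 : RatFunc k) = 0 :=
      (map_eq_zero_iff _ (algebraMap (RatFunc k) (Completion v.1)).injective).1 h0
    exact u.ne_zero (Subtype.ext h1)
  have h : localise φ v (Units.map (scalarHom b c S).toMonoidHom u)
      = scalarGL (Units.mk0 _ hu) := by
    apply Units.ext
    change φ v ((1 : Completion v.1) ⊗ₜ[RatFunc k] algebraMap (RatFunc k) (D b c) u.1.1) = _
    have h2 : (1 : Completion v.1) ⊗ₜ[RatFunc k] algebraMap (RatFunc k) (D b c) u.1.1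
        = algebraMap (Completion v.1) (LocalD b c v.1)
          (algebraMap (RatFunc k) (Completion v.1) u.1.1) := by
      rw [Algebra.algebraMap_eq_smul_one, TensorProduct.tmul_smul, TensorProduct.smul_tmul',
        ← Algebra.algebraMap_eq_smul_one]
      rfl
    rw [h2, AlgEquiv.commutes]
    rfl
  change localise φ v _ • x v = x v
  rw [h, scalarGL_smul_treeVertex]

/-- The action of `Λ_S` on the vertices of the product of trees. -/
def lambdaToPerm (φ : Splitting b c S) : Lambda b c S →* Equiv.Perm (ProductVertex φ) :=
  QuotientGroup.lift (scalarUnits b c S) (unitsToPerm φ) (unitsToPerm_scalar φ)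

instance (φ : Splitting b c S) : MulAction (Lambda b c S) (ProductVertex φ) :=
  MulAction.compHom _ (lambdaToPerm φ)

end QuatLattice

end

/-! The action is transitive and the stabiliser of one vertex has order 2(q+1). Both facts come from
the order H = k[t]⟨Z,F⟩ (`PolyOrder`).

Write N(x+yZ) = x² + bxy - cy². This form is anisotropic over k, so for polynomials N(p+qZ) has even
degree while tN(r+sZ), if nonzero, has odd degree. In the reduced norm N(u) - tN(w) of u + wF the
leading terms therefore never cancel: nonzero elements have nonzero norm, and H is Euclidean for the
degree of the norm. Hence right ideals of H are principal (`PolyOrder.exists_generator`); this plays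
the role of a class number one statement.

Transitivity. At each v ∈ S₀ choose a lattice M_v stable under H. Given lattices L_v, simultaneous
approximation yields x ∈ H with xM_v = L_v after rescaling the L_v. The elements of H carrying every
M_v into L_v form a right ideal gH. It contains a power of a polynomial f that vanishes exactly on
S₀, so g divides that power and is a unit away from S; it also contains x, so L_v = xM_v ⊆ gM_v ⊆
L_v.

Stabiliser. Principality also shows that an element with only powers of f as denominators that
preserves all M_v lies in H. So an element fixing the base vertex becomes, after scaling by an
S-unit and a power of t, a divisor in H of a power of t. Its norm is a constant times t^j, and
splitting off factors F one at a time gives (x+yZ)F^j with x, y ∈ k. Since F² = t is a scalar, the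
stabiliser consists of the classes of x+yZ and (x+yZ)F with (x:y) in P¹(k), which are 2(q+1) in
number.

Splittings exist because N represents t over the valuation ring at every place v ≠ 0, ∞: there is a
solution in the finite residue field, and Hensel's lemma lifts it. -/

noncomputable section

namespace QuatLattice

/-! ### Reduced norms -/

section ReducedNorm

variable {R : Type*} [CommRing R]

/-- The norm form `x² + bxy - cy²` of the quadratic algebra generated by `Z`, `Z² = c + bZ`. -/
def quadNorm (b c x y : R) : R := x ^ 2 + b * x * y - c * y ^ 2

/-- The reduced norm of a quaternion algebra. -/
def reducedNorm {a b c : R} (x : QuaternionAlgebra R a b c) : R :=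
  quadNorm b a x.re x.imI - c * quadNorm b a x.imJ x.imK

variable {a b c : R}

theorem reducedNorm_mul (x y : QuaternionAlgebra R a b c) :
    reducedNorm (x * y) = reducedNorm x * reducedNorm y := by
  simp only [reducedNorm, quadNorm, QuaternionAlgebra.re_mul, QuaternionAlgebra.imI_mul,
    QuaternionAlgebra.imJ_mul, QuaternionAlgebra.imK_mul]
  ring

theorem reducedNorm_star (x : QuaternionAlgebra R a b c) :
    reducedNorm (star x) = reducedNorm x := by
  simp only [reducedNorm, quadNorm, QuaternionAlgebra.re_star, QuaternionAlgebra.imI_star,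
    QuaternionAlgebra.imJ_star, QuaternionAlgebra.imK_star]
  ring

theorem star_mul_self_eq_reducedNorm (x : QuaternionAlgebra R a b c) :
    star x * x = QuaternionAlgebra.coe (reducedNorm x) := by
  ext : 1 <;> simp only [reducedNorm, quadNorm, QuaternionAlgebra.re_mul,
    QuaternionAlgebra.imI_mul, QuaternionAlgebra.imJ_mul, QuaternionAlgebra.imK_mul,
    QuaternionAlgebra.re_star, QuaternionAlgebra.imI_star, QuaternionAlgebra.imJ_star,
    QuaternionAlgebra.imK_star, QuaternionAlgebra.re_coe, QuaternionAlgebra.imI_coe,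
    QuaternionAlgebra.imJ_coe, QuaternionAlgebra.imK_coe] <;> ring

theorem reducedNorm_coe (r : R) :
    reducedNorm (QuaternionAlgebra.coe r : QuaternionAlgebra R a b c) = r ^ 2 := by
  simp [reducedNorm, quadNorm]

end ReducedNorm

/-! ### Anisotropy of the norm form and degree parity -/

section Anisotropy

variable {k : Type*} [Field k]

/-- If y ≠ 0, then x/y would be a square root of c (q odd) or a root of X² + X + c (q even, where
the sign of c is irrelevant). -/
theorem IsAdmissible.quadNorm_eq_zero [Fintype k] {b c : k} (h : IsAdmissible b c) {x y : k}
    (hxy : quadNorm b c x y = 0) : x = 0 ∧ y = 0 := by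
  have key : y = 0 := by
    by_contra hy
    rcases h with ⟨-, rfl, hc⟩ | ⟨hk, rfl, hc⟩
    · refine hc ⟨x / y, ?_⟩
      field_simp
      simp only [quadNorm] at hxy
      linear_combination -hxy
    · have h2 : ringChar k = 2 := FiniteField.even_card_iff_char_two.2 (Nat.even_iff.1 hk)
      have : CharP k 2 := h2 ▸ ringChar.charP k
      have hd : (X ^ 2 + X + C c : k[X]).degree = 2 := by compute_degree!
      have hroot : (X ^ 2 + X + C c : k[X]).IsRoot (x / y) := by
        have e : -c = c := CharTwo.neg_eq c
        simp only [quadNorm] at hxy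
        simp only [IsRoot, eval_add, eval_pow, eval_X, eval_C]
        field_simp
        linear_combination hxy - y ^ 2 * e
      have := degree_eq_one_of_irreducible_of_root hc hroot
      rw [hd] at this
      norm_num at this
  subst key
  simpa [quadNorm] using hxy

/-- The form takes the value -(b² + 4c) at (b, -2). If this were 0, anisotropy would give b = 0 and
2 = 0 at once, which neither parity of q allows. -/
theorem IsAdmissible.discr_ne_zero [Fintype k] {b c : k} (h : IsAdmissible b c) :
    b ^ 2 + 4 * c ≠ 0 := by
  intro h0
  have h1 : quadNorm b c b (-2) = 0 := by
    simp only [quadNorm]; linear_combination -h0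
  obtain ⟨rfl, h2⟩ := h.quadNorm_eq_zero h1
  rcases h with ⟨hk, -, -⟩ | ⟨-, h3, -⟩
  · have : ringChar k = 2 := by
      have h2' : (2 : k) = 0 := by simpa using h2
      by_contra hne
      exact Ring.two_ne_zero hne h2'
    rw [FiniteField.even_card_iff_char_two] at this
    exact (Nat.not_even_iff_odd.2 hk) (Nat.even_iff.2 this)
  · exact zero_ne_one h3

variable {b c : k} (han : ∀ x y : k, quadNorm b c x y = 0 → x = 0 ∧ y = 0)
include han

/-- With d the larger degree, the coefficient in degree 2d is the form evaluated at the d-th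
coefficients of p and q; by anisotropy it vanishes only when both polynomials are zero. -/
theorem natDegree_quadNorm (p q : k[X]) :
    (quadNorm (C b) (C c) p q).natDegree = 2 * max p.natDegree q.natDegree ∧
      (quadNorm (C b) (C c) p q = 0 → p = 0 ∧ q = 0) := by
  set d := max p.natDegree q.natDegree with hd
  have hp : p.natDegree ≤ d := le_max_left _ _
  have hq : q.natDegree ≤ d := le_max_right _ _
  have hco : (quadNorm (C b) (C c) p q).coeff (d + d) = quadNorm b c (p.coeff d) (q.coeff d) := by
    simp only [quadNorm, pow_two, mul_assoc, coeff_sub, coeff_add, coeff_C_mul,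
      coeff_mul_add_eq_of_natDegree_le hp hp, coeff_mul_add_eq_of_natDegree_le hp hq,
      coeff_mul_add_eq_of_natDegree_le hq hq]
  have hle : (quadNorm (C b) (C c) p q).natDegree ≤ d + d := by
    simp only [quadNorm, pow_two, mul_assoc]
    refine (natDegree_sub_le_of_le (natDegree_add_le_of_degree_le (natDegree_mul_le_of_le hp hp)
      ((natDegree_C_mul_le _ _).trans (natDegree_mul_le_of_le hp hq)))
      ((natDegree_C_mul_le _ _).trans (natDegree_mul_le_of_le hq hq))).trans ?_
    simp
  have hlead : p.coeff d = 0 ∧ q.coeff d = 0 → p = 0 ∧ q = 0 := by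
    rintro ⟨h1, h2⟩
    rcases le_total p.natDegree q.natDegree with h | h
    · rw [max_eq_right h] at hd
      rw [hd, coeff_natDegree, leadingCoeff_eq_zero] at h2
      subst h2
      rw [natDegree_zero] at hd
      rw [natDegree_zero, Nat.le_zero] at h
      rw [hd, ← h, coeff_natDegree, leadingCoeff_eq_zero] at h1
      exact ⟨h1, rfl⟩
    · rw [max_eq_left h] at hd
      rw [hd, coeff_natDegree, leadingCoeff_eq_zero] at h1
      subst h1
      rw [natDegree_zero] at hd
      rw [natDegree_zero, Nat.le_zero] at h
      rw [hd, ← h, coeff_natDegree, leadingCoeff_eq_zero] at h2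
      exact ⟨rfl, h2⟩
  refine ⟨?_, fun h0 => ?_⟩
  · by_cases h0 : quadNorm b c (p.coeff d) (q.coeff d) = 0
    · obtain ⟨rfl, rfl⟩ := hlead (han _ _ h0)
      simp [quadNorm, hd]
    · rw [two_mul]
      exact le_antisymm hle (le_natDegree_of_ne_zero (by rwa [hco]))
  · rw [h0, coeff_zero] at hco
    exact hlead (han _ _ hco.symm)

/-- The left degree is even and the right one odd. This is the ramification of D at infinity. -/
theorem natDegree_quadNorm_ne (p q r s : k[X]) (h : quadNorm (C b) (C c) r s ≠ 0) :
    (quadNorm (C b) (C c) p q).natDegree ≠ (X * quadNorm (C b) (C c) r s).natDegree := by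
  rw [natDegree_X_mul h, (natDegree_quadNorm han p q).1, (natDegree_quadNorm han r s).1]
  omega

end Anisotropy

/-! ### The polynomial order -/

section PolyOrder

variable {k : Type*} [Field k]

/-- The sections of `𝒜` over the affine line: the quaternion order over `k[t]` with basis
`1, Z, F, ZF`. -/
abbrev PolyOrder (b c : k) : Type _ := QuaternionAlgebra k[X] (C c) (C b) X

variable {b c : k} (han : ∀ x y : k, quadNorm b c x y = 0 → x = 0 ∧ y = 0)
include han

theorem PolyOrder.eq_zero_of_reducedNorm_eq_zero {h : PolyOrder b c} (h0 : reducedNorm h = 0) :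
    h = 0 := by
  have h1 := sub_eq_zero.1 h0
  have h2 : quadNorm (C b) (C c) h.imJ h.imK = 0 := by
    by_contra h2
    exact natDegree_quadNorm_ne han h.re h.imI _ _ h2 (congrArg natDegree h1)
  rw [h2, mul_zero] at h1
  obtain ⟨e1, e2⟩ := (natDegree_quadNorm han _ _).2 h1
  obtain ⟨e3, e4⟩ := (natDegree_quadNorm han _ _).2 h2
  ext <;> simp [e1, e2, e3, e4]

theorem PolyOrder.mul_left_cancel {g x y : PolyOrder b c} (hg : g ≠ 0) (h : g * x = g * y) :
    x = y := by
  have h1 : g * (x - y) = 0 := by rw [mul_sub, h, sub_self]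
  have h2 : reducedNorm g * reducedNorm (x - y) = 0 := by
    rw [← reducedNorm_mul, h1]; simp [reducedNorm, quadNorm]
  rcases mul_eq_zero.1 h2 with h3 | h3
  · exact absurd (eq_zero_of_reducedNorm_eq_zero han h3) hg
  · exact sub_eq_zero.1 (eq_zero_of_reducedNorm_eq_zero han h3)

omit han in
-- If deg N = d + 1, the coordinates have degree at most d, so the norm has degree at most 2d + 1,
-- the extra 1 coming from t. If N is constant, all coordinates are zero.
theorem PolyOrder.degree_reducedNorm_lt {r : PolyOrder b c} {N : k[X]} (hN : N ≠ 0)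
    (h1 : r.re.degree < N.degree) (h2 : r.imI.degree < N.degree) (h3 : r.imJ.degree < N.degree)
    (h4 : r.imK.degree < N.degree) (h0 : reducedNorm r ≠ 0) :
    (reducedNorm r).natDegree < 2 * N.natDegree := by
  rcases Nat.eq_zero_or_pos N.natDegree with hd | hd
  · have hz : ∀ p : k[X], p.degree < N.degree → p = 0 := by
      intro p hp
      rw [degree_eq_natDegree hN, hd] at hp
      exact degree_eq_bot.1 (by simpa using Nat.WithBot.lt_zero_iff.1 hp)
    exact absurd (by simp [reducedNorm, quadNorm, hz _ h1, hz _ h2, hz _ h3, hz _ h4]) h0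
  · obtain ⟨d, hdd⟩ : ∃ d, N.natDegree = d + 1 := ⟨N.natDegree - 1, by omega⟩
    have hz : ∀ p : k[X], p.degree < N.degree → p.natDegree ≤ d := by
      intro p hp
      rcases eq_or_ne p 0 with rfl | hp0
      · simp
      · have := natDegree_lt_natDegree hp0 hp
        omega
    have hq : ∀ p q : k[X], p.natDegree ≤ d → q.natDegree ≤ d →
        (quadNorm (C b) (C c) p q).natDegree ≤ d + d := by
      intro p q hp hq
      simp only [quadNorm, pow_two, mul_assoc]
      refine (natDegree_sub_le_of_le (natDegree_add_le_of_degree_le (natDegree_mul_le_of_le hp hp)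
        ((natDegree_C_mul_le _ _).trans (natDegree_mul_le_of_le hp hq)))
        ((natDegree_C_mul_le _ _).trans (natDegree_mul_le_of_le hq hq))).trans ?_
      simp
    have := natDegree_sub_le_of_le (hq _ _ (hz _ h1) (hz _ h2))
      (natDegree_mul_le_of_le (natDegree_X_le (R := k)) (hq _ _ (hz _ h3) (hz _ h4)))
    have h5 : (reducedNorm r).natDegree ≤ max (d + d) (1 + (d + d)) := this
    rw [max_eq_right (by omega)] at h5
    omega

/-- Divide ḡa coordinatewise by N = nr(g), with quotient r and remainder e. Then ḡ(a - gr) = e, and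
taking norms gives N · nr(a - gr) = nr(e), of degree below 2 deg N. -/
theorem PolyOrder.exists_remainder (a : PolyOrder b c) {g : PolyOrder b c} (hg : g ≠ 0) :
    ∃ r, a - g * r = 0 ∨
      (reducedNorm (a - g * r)).natDegree < (reducedNorm g).natDegree := by
  set N := reducedNorm g with hN
  have hN0 : N ≠ 0 := fun h => hg (eq_zero_of_reducedNorm_eq_zero han h)
  set w := star g * a with hw
  let r : PolyOrder b c := ⟨w.re / N, w.imI / N, w.imJ / N, w.imK / N⟩
  let e : PolyOrder b c := ⟨w.re % N, w.imI % N, w.imJ % N, w.imK % N⟩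
  refine ⟨r, or_iff_not_imp_left.2 fun hne => ?_⟩
  have he : star g * (a - g * r) = e := by
    rw [mul_sub, ← mul_assoc, star_mul_self_eq_reducedNorm, ← hN, ← hw,
      QuaternionAlgebra.coe_mul_eq_smul]
    have hdiv : ∀ p : k[X], p - N * (p / N) = p % N := fun p => by
      linear_combination -EuclideanDomain.div_add_mod p N
    ext : 1 <;> simp [r, e, hdiv]
  have hn : N * reducedNorm (a - g * r) = reducedNorm e := by
    rw [← he, reducedNorm_mul, reducedNorm_star]
  have hr0 : reducedNorm (a - g * r) ≠ 0 := fun h => hne (eq_zero_of_reducedNorm_eq_zero han h)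
  have hlt := degree_reducedNorm_lt (r := e) hN0 (EuclideanDomain.mod_lt _ hN0)
    (EuclideanDomain.mod_lt _ hN0) (EuclideanDomain.mod_lt _ hN0) (EuclideanDomain.mod_lt _ hN0)
    (by rw [← hn]; exact mul_ne_zero hN0 hr0)
  rw [← hn, natDegree_mul hN0 hr0] at hlt
  omega

/-- Right ideals of the polynomial order are principal. -/
theorem PolyOrder.exists_generator (I : AddSubgroup (PolyOrder b c))
    (hI : ∀ x ∈ I, ∀ r, x * r ∈ I) {z : PolyOrder b c} (hz : z ∈ I) (hz0 : z ≠ 0) :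
    ∃ g ∈ I, g ≠ 0 ∧ ∀ x ∈ I, ∃ r, x = g * r := by
  obtain ⟨g, ⟨hgI, hg0⟩, hmin⟩ := WellFounded.has_min
    (measure fun x : PolyOrder b c => (reducedNorm x).natDegree).wf {x | x ∈ I ∧ x ≠ 0} ⟨z, hz, hz0⟩
  refine ⟨g, hgI, hg0, fun x hx => ?_⟩
  obtain ⟨r, h | h⟩ := exists_remainder han x hg0
  · exact ⟨r, sub_eq_zero.1 h⟩
  · by_cases h0 : x - g * r = 0
    · exact ⟨r, sub_eq_zero.1 h0⟩
    · exact absurd h (hmin _ ⟨I.sub_mem hx (hI _ hgI _), h0⟩)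

/-- An element whose norm is a monomial is a constant of `k[Z]` times a power of `F`. -/
theorem PolyOrder.eq_const_mul_pow (j : ℕ) : ∀ (h : PolyOrder b c) (a : k), a ≠ 0 →
    reducedNorm h = C a * X ^ j →
    ∃ x y : k, h = ⟨C x, C y, 0, 0⟩ * (⟨0, 0, 1, 0⟩ : PolyOrder b c) ^ j := by
  induction j with
  | zero =>
    intro h a ha hh
    rw [pow_zero, mul_one] at hh
    have h1 : quadNorm (C b) (C c) h.re h.imI = C a + X * quadNorm (C b) (C c) h.imJ h.imK := by
      rw [← hh, reducedNorm]; ring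
    -- Otherwise the two parts of the norm would have equal degree, one even and one odd.
    have h2 : quadNorm (C b) (C c) h.imJ h.imK = 0 := by
      by_contra h2
      refine natDegree_quadNorm_ne han h.re h.imI _ _ h2 ?_
      rw [h1, add_comm, natDegree_add_C]
    obtain ⟨e3, e4⟩ := (natDegree_quadNorm han _ _).2 h2
    rw [h2, mul_zero, add_zero] at h1
    have h3 := (natDegree_quadNorm han h.re h.imI).1
    rw [h1, natDegree_C] at h3
    have h5 : h.re.natDegree = 0 := by
      have := le_max_left h.re.natDegree h.imI.natDegree; omega
    have h6 : h.imI.natDegree = 0 := by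
      have := le_max_right h.re.natDegree h.imI.natDegree; omega
    refine ⟨h.re.coeff 0, h.imI.coeff 0, ?_⟩
    rw [pow_zero, mul_one, ← eq_C_of_natDegree_eq_zero h5, ← eq_C_of_natDegree_eq_zero h6]
    ext : 1 <;> simp [e3, e4]
  | succ j ih =>
    intro h a ha hh
    -- At t = 0 the norm vanishes, so by anisotropy t divides the first two coordinates. As t = F²,
    -- a factor F then splits off on the right, of norm -t; hence the sign change of a.
    have hev : quadNorm b c (h.re.eval 0) (h.imI.eval 0) = 0 := by
      have := congrArg (eval 0) hh
      simpa [reducedNorm, quadNorm] using this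
    obtain ⟨h1, h2⟩ := han _ _ hev
    obtain ⟨p, hp⟩ := (dvd_iff_isRoot (a := (0 : k))).2 h1
    obtain ⟨q, hq⟩ := (dvd_iff_isRoot (a := (0 : k))).2 h2
    rw [C_0, sub_zero] at hp hq
    let h' : PolyOrder b c := ⟨h.imJ, h.imK, p, q⟩
    have hfac : h = h' * ⟨0, 0, 1, 0⟩ := by
      rw [QuaternionAlgebra.mk_mul_mk]
      ext : 1 <;> simp [hp, hq]
    have hn : reducedNorm h' = C (-a) * X ^ j := by
      have h3 : X * reducedNorm h' = X * (C (-a) * X ^ j) := by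
        have h4 : reducedNorm (⟨0, 0, 1, 0⟩ : PolyOrder b c) = -X := by
          simp [reducedNorm, quadNorm]
        have h5 := reducedNorm_mul h' ⟨0, 0, 1, 0⟩
        rw [← hfac, hh, h4] at h5
        rw [C_neg]
        linear_combination h5
      exact mul_left_cancel₀ X_ne_zero h3
    obtain ⟨x, y, hx⟩ := ih h' (-a) (neg_ne_zero.2 ha) hn
    exact ⟨x, y, by rw [pow_succ, ← mul_assoc, ← hx, ← hfac]⟩

end PolyOrder

/-! ### Lattices over a discrete valuation ring -/

section LocalLattice

open Filter

variable {O K : Type*} [CommRing O] [Field K] [Algebra O K]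

variable (K) in
/-- Every element of `K` becomes integral after multiplication by a high power of `ϖ`. -/
def IsAbsorbing (ϖ : O) : Prop :=
  ∀ x : K, ∃ n : ℕ, ∃ y : O, algebraMap O K y = algebraMap O K ϖ ^ n * x

/-! ### Comparison of lattices by powers of an absorbing element -/

section Comparison

variable {V : Type*} [AddCommGroup V] [Module K V] [Module O V]

theorem eventually_pow_smul_mem {ϖ : O} {L : Submodule O V} {m : V} {n : ℕ} (h : ϖ ^ n • m ∈ L) :
    ∀ᶠ n in atTop, ϖ ^ n • m ∈ L := by
  filter_upwards [eventually_ge_atTop n] with j hj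
  obtain ⟨i, rfl⟩ := Nat.exists_eq_add_of_le hj
  rw [add_comm, pow_add, mul_smul]
  exact L.smul_mem _ h

variable [IsScalarTower O K V] {ϖ : O} (hϖ : IsAbsorbing K ϖ)
include hϖ

theorem IsAbsorbing.eventually_smul_mem {L : Submodule O V}
    (hL : Submodule.span K (L : Set V) = ⊤) (m : V) : ∀ᶠ n in atTop, ϖ ^ n • m ∈ L := by
  have hm : m ∈ Submodule.span K (L : Set V) := hL ▸ Submodule.mem_top
  induction hm using Submodule.span_induction with
  | mem x hx => exact Eventually.of_forall fun n => L.smul_mem _ hx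
  | zero => simp
  | add x y _ _ hx hy =>
    filter_upwards [hx, hy] with n h1 h2
    rw [smul_add]; exact L.add_mem h1 h2
  | smul a x _ hx =>
    obtain ⟨n, hn⟩ := hx.exists
    obtain ⟨j, y, hy⟩ := hϖ a
    refine eventually_pow_smul_mem (n := j + n) ?_
    have : ϖ ^ (j + n) • a • x = y • ϖ ^ n • x := by
      rw [← algebraMap_smul K (ϖ ^ (j + n)), ← algebraMap_smul K y, ← algebraMap_smul K (ϖ ^ n),
        smul_smul, smul_smul, hy, map_pow, map_pow]
      congr 1; ring
    rw [this]
    exact L.smul_mem _ hn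

/-- It suffices to treat finitely many generators of M. Holding for all large n, the inclusion can
later be imposed at finitely many places with one exponent. -/
theorem IsAbsorbing.eventually_le {L M : Submodule O V}
    (hL : Submodule.span K (L : Set V) = ⊤) (hM : M.FG) :
    ∀ᶠ n in atTop, ∀ m ∈ M, ϖ ^ n • m ∈ L := by
  obtain ⟨s, rfl⟩ := hM
  have h : ∀ᶠ n in atTop, ∀ m ∈ s, ϖ ^ n • m ∈ L :=
    (eventually_all_finset s).2 fun m _ => hϖ.eventually_smul_mem hL m
  filter_upwards [h] with n hn m hm
  have h2 : Submodule.span O (s : Set V) ≤ L.comap (LinearMap.lsmul O V (ϖ ^ n)) :=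
    Submodule.span_le.2 hn
  exact h2 hm

end Comparison

theorem mem_translate {g : Matrix (Fin 2) (Fin 2) K} {L : Submodule O (Fin 2 → K)}
    {w : Fin 2 → K} : w ∈ translate g L ↔ ∃ m ∈ L, g.mulVec m = w := by
  simp [translate]

theorem translate_le {g : Matrix (Fin 2) (Fin 2) K} {L M : Submodule O (Fin 2 → K)} :
    translate g M ≤ L ↔ ∀ m ∈ M, g.mulVec m ∈ L := by
  simp [translate, SetLike.le_def]

/-- The lattice spanned by the images of the standard basis under a family of matrices. -/
def orbitLattice (B : Fin 4 → Matrix (Fin 2) (Fin 2) K) : Submodule O (Fin 2 → K) :=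
  Submodule.span O (Set.range fun p : Fin 4 × Fin 2 => (B p.1).mulVec (Pi.single p.2 1))

theorem isLattice_orbitLattice {B : Fin 4 → Matrix (Fin 2) (Fin 2) K} (h1 : B 0 = 1) :
    (orbitLattice B : Submodule O (Fin 2 → K)).IsLattice K where
  fg := Submodule.fg_span (Set.finite_range _)
  span_eq_top := by
    rw [orbitLattice, Submodule.span_span_of_tower, eq_top_iff, ← (Pi.basisFun K (Fin 2)).span_eq]
    refine Submodule.span_mono ?_
    rintro _ ⟨j, rfl⟩
    exact ⟨(0, j), by simp only [h1, Matrix.one_mulVec, Pi.basisFun_apply]⟩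

/-- Integral structure constants make the O-span of the family closed under multiplication. -/
theorem translate_orbitLattice_le {B : Fin 4 → Matrix (Fin 2) (Fin 2) K}
    (h : ∀ i j, ∃ c : Fin 4 → O, B i * B j = ∑ l, algebraMap O K (c l) • B l) (i : Fin 4) :
    translate (B i) (orbitLattice B : Submodule O (Fin 2 → K)) ≤ orbitLattice B := by
  rw [translate, Submodule.map_le_iff_le_comap]
  conv_lhs => rw [orbitLattice]
  rw [Submodule.span_le]
  rintro _ ⟨⟨j, e⟩, rfl⟩
  obtain ⟨c, hc⟩ := h i j
  have : (B i).mulVec ((B j).mulVec (Pi.single e 1)) ∈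
      (orbitLattice B : Submodule O (Fin 2 → K)) := by
    rw [Matrix.mulVec_mulVec, hc, Matrix.sum_mulVec]
    refine Submodule.sum_mem _ fun l _ => ?_
    rw [Matrix.smul_mulVec, algebraMap_smul]
    exact Submodule.smul_mem _ _ (Submodule.subset_span ⟨(l, e), rfl⟩)
  simpa using this

variable [IsDomain O] [IsFractionRing O K]

/-- Both lattices are free of rank 2 over a principal ideal domain; y matches a basis of one with a
basis of the other. -/
theorem exists_translate_eq [IsPrincipalIdealRing O] (M L : Submodule O (Fin 2 → K))
    [M.IsLattice K] [L.IsLattice K] : ∃ y : Matrix (Fin 2) (Fin 2) K, translate y M = L := by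
  have hK : Module.IsTorsionFree O K := inferInstance
  let bM : Module.Basis (Fin 2) O M := Module.finBasisOfFinrankEq O M
    (by rw [Submodule.IsLattice.finrank_of_pi (K := K)]; simp)
  let bL : Module.Basis (Fin 2) O L := Module.finBasisOfFinrankEq O L
    (by rw [Submodule.IsLattice.finrank_of_pi (K := K)]; simp)
  have hspan : ∀ (N : Submodule O (Fin 2 → K)) (b : Module.Basis (Fin 2) O N),
      N = Submodule.span O (Set.range fun i => (b i : Fin 2 → K)) := by
    intro N b
    have := congrArg (Submodule.map N.subtype) b.span_eq
    rw [Submodule.map_span, Submodule.map_top, Submodule.range_subtype, ← Set.range_comp] at this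
    exact this.symm
  refine ⟨LinearMap.toMatrix' ((bM.extendOfIsLattice K).equiv (bL.extendOfIsLattice K)
    (Equiv.refl _)).toLinearMap, ?_⟩
  rw [translate, Matrix.toLin'_toMatrix']
  refine (congrArg (Submodule.map _) (hspan M bM)).trans ?_
  rw [Submodule.map_span, ← Set.range_comp]
  refine Eq.trans ?_ (hspan L bL).symm
  congr 2
  funext i
  have := (bM.extendOfIsLattice K).equiv_apply (b' := bL.extendOfIsLattice K) i (Equiv.refl _)
  simpa using this

/-- The coordinates of the endomorphisms of a lattice have bounded denominators. -/
theorem IsAbsorbing.exists_pow_mul_repr [IsPrincipalIdealRing O] {ϖ : O} (hϖ : IsAbsorbing K ϖ)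
    (B : Module.Basis (Fin 4) K (Matrix (Fin 2) (Fin 2) K)) (M : Submodule O (Fin 2 → K))
    [M.IsLattice K] :
    ∀ᶠ n in atTop, ∀ y, translate y M ≤ M → ∀ i, ∃ a : O,
      algebraMap O K a = algebraMap O K ϖ ^ n * B.repr y i := by
  obtain ⟨s, hs⟩ : M.FG := Submodule.IsLattice.fg (A := K)
  have hspan := Submodule.IsLattice.span_eq_top (A := K) (M := M)
  rw [← hs, Submodule.span_span_of_tower] at hspan
  -- E is the endomorphism order of M. Evaluation on generators embeds it in a finite power of M, so
  -- it is finitely generated and can be compared with the lattice spanned by B.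
  let E : Submodule O (Matrix (Fin 2) (Fin 2) K) :=
    { carrier := {y | ∀ m ∈ M, y.mulVec m ∈ M}
      zero_mem' := fun m _ => by simp
      add_mem' := fun ha hb m hm => by rw [Matrix.add_mulVec]; exact M.add_mem (ha m hm) (hb m hm)
      smul_mem' := fun c y hy m hm => by rw [Matrix.smul_mulVec]; exact M.smul_mem _ (hy m hm) }
  let ev : E →ₗ[O] (s → M) :=
    { toFun := fun y m => ⟨y.1.mulVec m.1, y.2 _ (hs ▸ Submodule.subset_span m.2)⟩
      map_add' := fun a b => funext fun m => Subtype.ext (Matrix.add_mulVec a.1 b.1 m.1)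
      map_smul' := fun c y => funext fun m => Subtype.ext (Matrix.smul_mulVec c y.1 m.1) }
  have hev : Function.Injective ev := by
    intro y z hyz
    apply Subtype.ext
    apply Matrix.toLin'.injective
    refine LinearMap.ext_on hspan fun m hm => ?_
    exact congrArg Subtype.val (congrFun hyz ⟨m, hm⟩)
  have : IsNoetherian O E := isNoetherian_of_injective ev hev
  have hE : E.FG := Module.Finite.iff_fg.1 inferInstance
  have hB : Submodule.span K
      (Submodule.span O (Set.range B) : Set (Matrix (Fin 2) (Fin 2) K)) = ⊤ := by
    rw [Submodule.span_span_of_tower, B.span_eq]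
  filter_upwards [hϖ.eventually_le hB hE] with n hn y hy i
  have h2 := (B.mem_span_iff_repr_mem O _).1 (hn y (translate_le.1 hy)) i
  obtain ⟨a, ha⟩ := h2
  refine ⟨a, ?_⟩
  rw [ha, ← algebraMap_smul K (ϖ ^ n) y, map_smul, Finsupp.smul_apply, map_pow, smul_eq_mul]

omit [IsDomain O] [IsFractionRing O K] in
/-- A small perturbation of a matrix carrying `M` onto `L` still carries `M` onto `L`. -/
theorem translate_eq_of_sub_mem [IsLocalRing O] {ϖ : O} (hm : ϖ ∈ IsLocalRing.maximalIdeal O)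
    {M L : Submodule O (Fin 2 → K)} (hL : L.FG) {x y : Matrix (Fin 2) (Fin 2) K}
    (hy : translate y M = L) (h : ∀ m ∈ M, ∃ l ∈ L, (x - y).mulVec m = ϖ • l) :
    translate x M = L := by
  refine le_antisymm (translate_le.2 fun m hmM => ?_) ?_
  · obtain ⟨l, hl, e⟩ := h m hmM
    rw [← sub_add_cancel x y, Matrix.add_mulVec, e]
    exact L.add_mem (L.smul_mem _ hl) (translate_le.1 hy.le m hmM)
  -- Nakayama's lemma: L is contained in xM + 𝔪L.
  · refine Submodule.le_of_le_smul_of_le_jacobson_bot (I := IsLocalRing.maximalIdeal O) hL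
      (IsLocalRing.jacobson_eq_maximalIdeal _ bot_ne_top).ge fun l hl => ?_
    rw [← hy, mem_translate] at hl
    obtain ⟨m, hmM, rfl⟩ := hl
    obtain ⟨l, hl, e⟩ := h m hmM
    have : y.mulVec m = x.mulVec m - ϖ • l := by rw [← e, Matrix.sub_mulVec]; abel
    rw [this]
    exact Submodule.sub_mem _ (Submodule.mem_sup_left (mem_translate.2 ⟨m, hmM, rfl⟩))
      (Submodule.mem_sup_right (Submodule.smul_mem_smul hm hl))

omit [IsDomain O] [IsFractionRing O K] in
-- Here ϖ^n already carries M into L; the one further factor ϖ moves the error into ϖL, as the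
-- perturbation argument requires.
theorem translate_eq_of_coord_sub [IsLocalRing O] {ϖ : O} (hm : ϖ ∈ IsLocalRing.maximalIdeal O)
    {M L : Submodule O (Fin 2 → K)} (hL : L.FG) {B : Fin 4 → Matrix (Fin 2) (Fin 2) K}
    (hB : ∀ i, translate (B i) M ≤ M) {n : ℕ} (hn : ∀ m ∈ M, ϖ ^ n • m ∈ L) {a α : Fin 4 → K}
    (hy : translate (∑ i, a i • B i) M = L)
    (h : ∀ i, ∃ c : O, α i - a i = algebraMap O K (ϖ ^ (n + 1) * c)) :
    translate (∑ i, α i • B i) M = L := by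
  choose c hc using h
  refine translate_eq_of_sub_mem hm hL hy fun m hmM =>
    ⟨∑ i, c i • ϖ ^ n • (B i).mulVec m, Submodule.sum_mem _ fun i _ =>
      L.smul_mem _ (hn _ (translate_le.1 (hB i) m hmM)), ?_⟩
  rw [← Finset.sum_sub_distrib, Matrix.sum_mulVec, Finset.smul_sum]
  refine Finset.sum_congr rfl fun i _ => ?_
  rw [← sub_smul, hc, Matrix.smul_mulVec, algebraMap_smul, smul_smul, smul_smul, pow_succ]
  congr 1; ring

end LocalLattice

/-! ### Completions of `k(t)` at finite places -/

section Completions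

variable {k : Type*} [Field k]

/-- The valuation ring of the completion of `k(t)` at a finite place. -/
abbrev CompletionIntegers (v : HeightOneSpectrum k[X]) : Type _ :=
  v.adicCompletionIntegers (RatFunc k)

variable (v : HeightOneSpectrum k[X])

theorem valued_algebraMap (x : RatFunc k) :
    Valued.v (algebraMap (RatFunc k) (Completion v) x) = v.valuation (RatFunc k) x :=
  v.valuedAdicCompletion_eq_valuation' x

theorem coe_algebraMap_completionIntegers (p : k[X]) :
    algebraMap (CompletionIntegers v) (Completion v) (algebraMap k[X] (CompletionIntegers v) p)
      = algebraMap (RatFunc k) (Completion v) (algebraMap k[X] (RatFunc k) p) := rfl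

theorem valued_poly (p : k[X]) :
    Valued.v (algebraMap (CompletionIntegers v) (Completion v)
      (algebraMap k[X] (CompletionIntegers v) p)) = v.intValuation p := by
  rw [coe_algebraMap_completionIntegers, valued_algebraMap, v.valuation_of_algebraMap]

variable {v}

theorem exists_mul_of_valued_le {d x : Completion v} (hd : d ≠ 0) (h : Valued.v x ≤ Valued.v d) :
    ∃ c : CompletionIntegers v, x = d * algebraMap _ (Completion v) c := by
  have hv : Valued.v d ≠ 0 := (Valuation.ne_zero_iff _).2 hd
  refine ⟨⟨x / d, ?_⟩, ?_⟩
  · rw [HeightOneSpectrum.mem_adicCompletionIntegers, map_div₀]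
    exact div_le_one_of_le₀ h zero_le
  · change x = d * (x / d)
    field_simp

theorem isAbsorbing_poly {f : k[X]} (hf : f ∈ v.asIdeal) :
    IsAbsorbing (Completion v) (algebraMap k[X] (CompletionIntegers v) f) := by
  intro x
  obtain ⟨n, hn⟩ : ∃ n : ℕ, Valued.v (algebraMap (CompletionIntegers v) (Completion v)
      (algebraMap k[X] (CompletionIntegers v) f) ^ n * x) ≤ 1 := by
    have h1 := (v.intValuation_lt_one_iff_mem f).2 hf
    rw [← valued_poly v] at h1
    simp only [map_mul, map_pow]
    generalize Valued.v (algebraMap (CompletionIntegers v) (Completion v)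
      (algebraMap k[X] (CompletionIntegers v) f)) = y at h1
    generalize Valued.v x = z
    induction z using WithZero.expRecOn with
    | zero => simp
    | exp m =>
      induction y using WithZero.expRecOn with
      | zero => exact ⟨1, by simp⟩
      | exp e =>
        rw [← WithZero.exp_zero, WithZero.exp_lt_exp] at h1
        -- Since e ≤ -1, multiplying m⁺ times cancels a pole of order m.
        refine ⟨m.toNat, ?_⟩
        rw [← WithZero.exp_nsmul, ← WithZero.exp_add, ← WithZero.exp_zero, WithZero.exp_le_exp,
          nsmul_eq_mul]
        have := Int.self_le_toNat m
        nlinarith [Int.natCast_nonneg m.toNat]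
  exact ⟨n, ⟨_, hn⟩, rfl⟩

theorem poly_mem_maximalIdeal {f : k[X]} (hf : f ∈ v.asIdeal) :
    algebraMap k[X] (CompletionIntegers v) f ∈
      IsLocalRing.maximalIdeal (CompletionIntegers v) := by
  rw [IsLocalRing.mem_maximalIdeal, mem_nonunits_iff,
    HeightOneSpectrum.adicCompletionIntegers.isUnit_iff_valued_eq_one]
  have h1 := (v.intValuation_lt_one_iff_mem f).2 hf
  rw [← valued_poly v] at h1
  exact h1.ne

variable (v) in
/-- The open balls of the completion are neighbourhoods. -/
theorem setOf_valued_sub_lt_mem_nhds (x : Completion v) {d : Completion v} (hd : d ≠ 0) :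
    {y | Valued.v (y - x) < Valued.v d} ∈ nhds x := by
  rw [Valued.mem_nhds]
  have h0 : (Valued.v (R := Completion v)).restrict d ≠ 0 := by
    simpa using hd
  refine ⟨Units.mk0 _ h0, fun y hy => ?_⟩
  exact (Valuation.restrict_lt_iff _).1 hy

/-- `k[t]` is dense in the valuation ring of the completion. -/
theorem exists_poly_sub_lt (a : CompletionIntegers v) {d : Completion v} (hd : d ≠ 0) :
    ∃ p : k[X], Valued.v (algebraMap (CompletionIntegers v) (Completion v)
      (algebraMap k[X] (CompletionIntegers v) p - a)) < Valued.v d := by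
  -- The radius is shrunk to at most 1, so that the approximating rational function is itself
  -- integral at v and can in turn be approximated by a polynomial.
  obtain ⟨d', hd', h1, h2⟩ : ∃ d' : Completion v, d' ≠ 0 ∧ Valued.v d' ≤ 1 ∧
      Valued.v d' ≤ Valued.v d := by
    rcases le_total (Valued.v d) 1 with h | h
    · exact ⟨d, hd, h, le_rfl⟩
    · exact ⟨1, one_ne_zero, by simp, by simpa using h⟩
  obtain ⟨x, hx⟩ := (HeightOneSpectrum.denseRange_algebraMap (RatFunc k) v).exists_mem_open
    (s := interior {y | Valued.v (y - a.1) < Valued.v d'}) isOpen_interior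
    ⟨a.1, mem_interior_iff_mem_nhds.2 (setOf_valued_sub_lt_mem_nhds v a.1 hd')⟩
  replace hx := interior_subset hx
  rw [Set.mem_ofPred_eq] at hx
  have hx1 : v.valuation (RatFunc k) x ≤ 1 := by
    rw [← valued_algebraMap, ← sub_add_cancel (algebraMap (RatFunc k) (Completion v) x) a.1]
    exact (Valuation.map_add _ _ _).trans (max_le (hx.le.trans h1) a.2)
  have hvd : Valued.v d' ≠ 0 := (Valuation.ne_zero_iff _).2 hd'
  obtain ⟨p, hp⟩ := v.exists_valuation_sub_lt_of_integer hx1 (Units.mk0 _ hvd)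
  rw [← valued_algebraMap, map_sub, Units.val_mk0] at hp
  refine ⟨p, lt_of_lt_of_le ?_ h2⟩
  rw [map_sub, coe_algebraMap_completionIntegers,
    ← sub_add_sub_cancel _ (algebraMap (RatFunc k) (Completion v) x)]
  exact (Valuation.map_add _ _ _).trans_lt (max_lt hp hx)

/-- Simultaneous approximation by polynomials at finitely many places. -/
theorem exists_poly_approx {ι : Type*} [Finite ι] (v : ι → HeightOneSpectrum k[X])
    (hv : Function.Injective v) (f : k[X]) (hf : f ≠ 0) (n : ℕ)
    (a : ∀ i, CompletionIntegers (v i)) :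
    ∃ p : k[X], ∀ i, ∃ c : CompletionIntegers (v i),
      algebraMap k[X] (CompletionIntegers (v i)) p - a i
        = algebraMap k[X] (CompletionIntegers (v i)) f ^ n * c := by
  classical
  have := Fintype.ofFinite ι
  have hd : ∀ i, (algebraMap (CompletionIntegers (v i)) (Completion (v i))
      (algebraMap k[X] (CompletionIntegers (v i)) f)) ^ n ≠ 0 := by
    intro i
    refine pow_ne_zero _ ?_
    rw [coe_algebraMap_completionIntegers]
    simpa using hf
  -- First approximate by a polynomial at each place separately; the Chinese remainder theorem then
  -- glues these modulo high powers of the primes.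
  choose q hq using fun i => exists_poly_sub_lt (a i) (hd i)
  have hm : ∀ i, ∃ m : ℕ, WithZero.exp (-(m : ℤ)) ≤ (v i).intValuation (f ^ n) := by
    intro i
    have h0 := (v i).intValuation_ne_zero (f ^ n) (pow_ne_zero _ hf)
    generalize (v i).intValuation (f ^ n) = z at h0
    induction z using WithZero.expRecOn with
    | zero => exact absurd rfl h0
    | exp e =>
      refine ⟨e.natAbs, ?_⟩
      rw [WithZero.exp_le_exp]
      omega
  choose m hm using hm
  obtain ⟨p, hp⟩ := IsDedekindDomain.exists_forall_sub_mem_ideal (s := Finset.univ)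
    (fun i => (v i).asIdeal) m (fun i _ => (v i).prime)
    (fun i _ j _ hij h => hij (hv (HeightOneSpectrum.ext h))) (fun i => q i.1)
  refine ⟨p, fun i => ?_⟩
  have h1 := hp i (Finset.mem_univ i)
  rw [← (v i).intValuation_le_pow_iff_mem] at h1
  have h2 : Valued.v (algebraMap (CompletionIntegers (v i)) (Completion (v i))
      (algebraMap k[X] (CompletionIntegers (v i)) p - a i)) ≤
      Valued.v ((algebraMap (CompletionIntegers (v i)) (Completion (v i))
        (algebraMap k[X] (CompletionIntegers (v i)) f)) ^ n) := by
    have : algebraMap k[X] (CompletionIntegers (v i)) p - a i =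
        algebraMap k[X] (CompletionIntegers (v i)) (p - q i) +
          (algebraMap k[X] (CompletionIntegers (v i)) (q i) - a i) := by
      rw [map_sub]; ring
    rw [this, map_add]
    refine (Valuation.map_add _ _ _).trans (max_le ?_ (hq i).le)
    rw [valued_poly, ← map_pow, ← map_pow, valued_poly]
    exact h1.trans (hm i)
  obtain ⟨c, hc⟩ := exists_mul_of_valued_le (hd i) h2
  refine ⟨c, FaithfulSMul.algebraMap_injective (CompletionIntegers (v i)) (Completion (v i)) ?_⟩
  rw [hc, map_mul, map_pow]

end Completions

/-! ### Completeness of the valuation rings -/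

section Complete

variable {k : Type*} [Field k] (v : HeightOneSpectrum k[X])

theorem exists_generator_maximalIdeal : ∃ π : CompletionIntegers v, π ≠ 0 ∧
    Valued.v (π : Completion v) = WithZero.exp (-1 : ℤ) ∧
    IsLocalRing.maximalIdeal (CompletionIntegers v) = Ideal.span {π} := by
  obtain ⟨p, hp⟩ := v.intValuation_exists_uniformizer
  have hv : Valued.v ((algebraMap k[X] (CompletionIntegers v) p : CompletionIntegers v) :
      Completion v) = WithZero.exp (-1 : ℤ) := by
    rw [← hp]; exact valued_poly v p
  have h0 : ((algebraMap k[X] (CompletionIntegers v) p : CompletionIntegers v) :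
      Completion v) ≠ 0 := by
    intro h; rw [h, map_zero] at hv; exact WithZero.exp_ne_zero hv.symm
  refine ⟨algebraMap k[X] _ p, fun h => h0 (by rw [h]; rfl), hv, le_antisymm (fun x hx => ?_) ?_⟩
  · rw [IsLocalRing.mem_maximalIdeal, mem_nonunits_iff,
      HeightOneSpectrum.adicCompletionIntegers.isUnit_iff_valued_eq_one] at hx
    have hlt : Valued.v x.1 < 1 := lt_of_le_of_ne x.2 hx
    have hle : Valued.v x.1 ≤ WithZero.exp (-1 : ℤ) := by
      generalize Valued.v x.1 = z at hlt
      induction z using WithZero.expRecOn with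
      | zero => simp
      | exp n =>
        rw [← WithZero.exp_zero, WithZero.exp_lt_exp] at hlt
        rw [WithZero.exp_le_exp]; omega
    obtain ⟨c, hc⟩ := exists_mul_of_valued_le h0 (hle.trans hv.ge)
    exact Ideal.mem_span_singleton'.2 ⟨c, Subtype.ext ((mul_comm _ _).trans hc.symm)⟩
  · rw [Ideal.span_singleton_le_iff_mem, IsLocalRing.mem_maximalIdeal, mem_nonunits_iff,
      HeightOneSpectrum.adicCompletionIntegers.isUnit_iff_valued_eq_one, hv]
    rw [← WithZero.exp_zero]
    exact fun h => by simpa using WithZero.exp_injective h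

theorem mem_maximalIdeal_pow_iff (x : CompletionIntegers v) (n : ℕ) :
    x ∈ IsLocalRing.maximalIdeal (CompletionIntegers v) ^ n ↔
      Valued.v (x : Completion v) ≤ WithZero.exp (-(n : ℤ)) := by
  obtain ⟨π, h0, hv, hm⟩ := exists_generator_maximalIdeal v
  have hvn : Valued.v ((π : Completion v) ^ n) = WithZero.exp (-(n : ℤ)) := by
    rw [map_pow, hv, ← WithZero.exp_nsmul]; simp
  rw [hm, Ideal.span_singleton_pow, Ideal.mem_span_singleton', ← hvn]
  constructor
  · rintro ⟨c, rfl⟩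
    change Valued.v ((c : Completion v) * (π : Completion v) ^ n) ≤ _
    rw [map_mul]
    exact mul_le_of_le_one_left' c.2
  · intro h
    obtain ⟨c, hc⟩ := exists_mul_of_valued_le
      (pow_ne_zero n (fun h => h0 (Subtype.ext h) : (π : Completion v) ≠ 0)) h
    exact ⟨c, Subtype.ext ((mul_comm _ _).trans hc.symm)⟩

theorem exists_exp_lt {γ : ℤᵐ⁰} (h0 : γ ≠ 0) : ∃ n : ℕ, WithZero.exp (-(n : ℤ)) < γ := by
  induction γ using WithZero.expRecOn with
  | zero => exact absurd rfl h0
  | exp e => exact ⟨e.natAbs + 1, by rw [WithZero.exp_lt_exp]; have := neg_abs_le e; push_cast; omega⟩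

/-- Powers of the maximal ideal are the balls of radius exp(-n), so adic completeness is topological
completeness. It is needed for Hensel's lemma. -/
instance isAdicComplete_completionIntegers :
    IsAdicComplete (IsLocalRing.maximalIdeal (CompletionIntegers v)) (CompletionIntegers v) where
  prec' f hf := by
    have hf' : ∀ {m n : ℕ}, m ≤ n →
        Valued.v ((f m : Completion v) - f n) ≤ WithZero.exp (-(m : ℤ)) := by
      intro m n hmn
      have := hf hmn
      rw [smul_eq_mul, Ideal.mul_top, SModEq.sub_mem, mem_maximalIdeal_pow_iff] at this
      exact this
    have hc : CauchySeq fun n => (f n : Completion v) := by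
      rw [(Valued.hasBasis_uniformity (Completion v) ℤᵐ⁰).cauchySeq_iff]
      intro γ _
      obtain ⟨n, hn⟩ := exists_exp_lt
        (γ := MonoidWithZeroHom.ValueGroup₀.embedding γ.1) (by simp)
      refine ⟨n, fun i hi j hj => ?_⟩
      change (Valued.v (R := Completion v)).restrict _ < γ.1
      rw [Valuation.restrict_lt_iff_lt_embedding]
      refine lt_of_le_of_lt ?_ hn
      rw [← sub_sub_sub_cancel_left _ _ (f n : Completion v)]
      exact (Valuation.map_sub _ _ _).trans (max_le (hf' hi) (hf' hj))
    obtain ⟨L, hL⟩ := cauchySeq_tendsto_of_complete hc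
    have hlim : ∀ n : ℕ, Valued.v ((f n : Completion v) - L) ≤ WithZero.exp (-(n : ℤ)) := by
      intro n
      obtain ⟨d, hd⟩ := v.valuedAdicCompletion_surjective (RatFunc k) (WithZero.exp (-(n : ℤ)))
      have hd0 : d ≠ 0 := by
        rintro rfl
        rw [map_zero] at hd; exact WithZero.exp_ne_zero hd.symm
      have h1 := hL.eventually (setOf_valued_sub_lt_mem_nhds v L hd0)
      obtain ⟨m, hm, hmn⟩ := (h1.and (Filter.eventually_ge_atTop n)).exists
      rw [← sub_add_sub_cancel _ (f m : Completion v)]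
      exact (Valuation.map_add _ _ _).trans (max_le (hf' hmn) (hm.le.trans hd.le))
    have hLO : Valued.v L ≤ 1 := by
      have := Valuation.map_sub Valued.v (f 0 : Completion v) ((f 0 : Completion v) - L)
      rw [sub_sub_cancel] at this
      refine this.trans (max_le (f 0).2 ?_)
      simpa using hlim 0
    refine ⟨⟨L, hLO⟩, fun n => ?_⟩
    rw [smul_eq_mul, Ideal.mul_top, SModEq.sub_mem, mem_maximalIdeal_pow_iff]
    exact hlim n

end Complete

/-! ### Local solvability of the norm equation -/

section NormEquation

variable {k : Type*} [Field k] [Fintype k] {b c : k}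

theorem finite_residueField (v : HeightOneSpectrum k[X]) : Finite (k[X] ⧸ v.asIdeal) := by
  have hg : Submodule.IsPrincipal.generator v.asIdeal ≠ 0 := fun h =>
    v.ne_bot ((Submodule.IsPrincipal.eq_bot_iff_generator_eq_zero _).2 h)
  rw [← Ideal.span_singleton_generator v.asIdeal]
  have : Module.Finite k (AdjoinRoot (Submodule.IsPrincipal.generator v.asIdeal)) :=
    (AdjoinRoot.powerBasis hg).finite
  exact Module.finite_of_finite k (M := AdjoinRoot (Submodule.IsPrincipal.generator v.asIdeal))

/-- The residue field is finite. In odd characteristic, counting the values of x² - t and -cy² gives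
a solution; in characteristic 2 every element is a square, so y = 0 works. -/
theorem IsAdmissible.exists_residue_solution (h : IsAdmissible b c) (v : HeightOneSpectrum k[X]) :
    ∃ x y : k[X], quadNorm (C b) (C c) x y - X ∈ v.asIdeal := by
  have := v.isMaximal
  have hfin := finite_residueField v
  let _ : Field (k[X] ⧸ v.asIdeal) := Ideal.Quotient.field _
  let _ := Fintype.ofFinite (k[X] ⧸ v.asIdeal)
  suffices ∃ x y : k[X] ⧸ v.asIdeal, quadNorm (Ideal.Quotient.mk v.asIdeal (C b))
      (Ideal.Quotient.mk v.asIdeal (C c)) x y = Ideal.Quotient.mk v.asIdeal X by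
    obtain ⟨x, y, hxy⟩ := this
    obtain ⟨x, rfl⟩ := Ideal.Quotient.mk_surjective x
    obtain ⟨y, rfl⟩ := Ideal.Quotient.mk_surjective y
    refine ⟨x, y, ?_⟩
    rw [← Ideal.Quotient.mk_eq_mk_iff_sub_mem, ← hxy]
    simp [quadNorm]
  have hinj : Function.Injective ((Ideal.Quotient.mk v.asIdeal).comp (C : k →+* k[X])) :=
    RingHom.injective _
  have h2 : ringChar k = 2 ↔ ringChar (k[X] ⧸ v.asIdeal) = 2 := by
    have := (RingHom.charP_iff _ hinj (ringChar k)).1 inferInstance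
    rw [← ringChar.eq (k[X] ⧸ v.asIdeal) (ringChar k)]
  rcases h with ⟨hk, rfl, hc⟩ | ⟨hk, -, -⟩
  · have hodd : Fintype.card (k[X] ⧸ v.asIdeal) % 2 = 1 := by
      rw [← Nat.not_even_iff_odd, Nat.even_iff, ← FiniteField.even_card_iff_char_two, h2,
        FiniteField.even_card_iff_char_two] at hk
      omega
    have hc0 : Ideal.Quotient.mk v.asIdeal (C c) ≠ 0 := by
      have : c ≠ 0 := by rintro rfl; exact hc ⟨0, by simp⟩
      exact (map_ne_zero ((Ideal.Quotient.mk v.asIdeal).comp (C : k →+* k[X]))).2 this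
    obtain ⟨x, y, hxy⟩ := FiniteField.exists_root_sum_quadratic
      (f := (X ^ 2 - C (Ideal.Quotient.mk v.asIdeal X) : (k[X] ⧸ v.asIdeal)[X]))
      (g := C (-Ideal.Quotient.mk v.asIdeal (C c)) * X ^ 2)
      (by compute_degree!) (degree_C_mul_X_pow 2 (neg_ne_zero.2 hc0)) hodd
    refine ⟨x, y, ?_⟩
    simp only [eval_sub, eval_pow, eval_X, eval_C, eval_mul] at hxy
    simp only [quadNorm, map_zero]
    linear_combination hxy
  · rw [← Nat.not_odd_iff_even, Nat.odd_iff, Nat.mod_two_not_eq_one,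
      ← FiniteField.even_card_iff_char_two, h2] at hk
    obtain ⟨x, hx⟩ := FiniteField.isSquare_of_char_two hk (Ideal.Quotient.mk v.asIdeal X)
    exact ⟨x, 0, by rw [hx, quadNorm]; ring⟩

omit [Fintype k] in
theorem C_not_mem {v : HeightOneSpectrum k[X]} {a : k} (ha : a ≠ 0) : C a ∉ v.asIdeal := fun h =>
  v.isPrime.ne_top (Ideal.eq_top_of_isUnit_mem _ h (isUnit_C.2 ha.isUnit))

omit [Fintype k] in
theorem X_not_mem {v : HeightOneSpectrum k[X]} (hv : Place.finite v ≠ Place.zero k) :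
    (X : k[X]) ∉ v.asIdeal := by
  intro h
  refine hv (congrArg Place.finite (HeightOneSpectrum.ext ?_))
  have hle : (Polynomial.idealX k).asIdeal ≤ v.asIdeal := by
    rw [Polynomial.idealX_span, Ideal.span_singleton_le_iff_mem]
    exact h
  exact ((Polynomial.idealX k).isMaximal.eq_of_le v.isPrime.ne_top hle).symm

omit [Fintype k] in
theorem exists_root_of_isUnit_derivative (v : HeightOneSpectrum k[X]) (p q x : k[X])
    (h : x ^ 2 + p * x + q ∈ v.asIdeal) (h' : 2 * x + p ∉ v.asIdeal) :
    ∃ z : CompletionIntegers v, z ^ 2 + algebraMap k[X] _ p * z + algebraMap k[X] _ q = 0 := by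
  set a := algebraMap k[X] (CompletionIntegers v) with ha
  have hmon : (X ^ 2 + C (a p) * X + C (a q)).Monic := by monicity!
  obtain ⟨z, hz, -⟩ := HenselianRing.is_henselian
    (I := IsLocalRing.maximalIdeal (CompletionIntegers v)) _ hmon (a x) (by
      have := poly_mem_maximalIdeal h
      simpa [← ha] using this) (by
      refine IsUnit.map _ ?_
      have h1 : v.intValuation (2 * x + p) = 1 := by
        refine le_antisymm (v.intValuation_le_one _) (not_lt.1 fun hlt => h' ?_)
        exact (v.intValuation_lt_one_iff_mem _).1 hlt
      have h2 : IsUnit (a (2 * x + p)) := by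
        rw [HeightOneSpectrum.adicCompletionIntegers.isUnit_iff_valued_eq_one]
        exact (valued_poly v _).trans h1
      simpa [two_mul, one_add_one_eq_two] using h2)
  exact ⟨z, by simpa [IsRoot] using hz⟩

/-- The residue solution is a smooth point: if both partial derivatives 2x + by and bx - 2cy
vanished, the nonzero discriminant would force x = y = 0, hence t = 0 in the residue field. Hensel's
lemma is applied in a variable whose derivative is nonzero. -/
theorem IsAdmissible.exists_quadNorm_eq (h : IsAdmissible b c) {v : HeightOneSpectrum k[X]}
    (hv : Place.finite v ≠ Place.zero k) : ∃ x y : CompletionIntegers v,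
    quadNorm (algebraMap k[X] _ (C b)) (algebraMap k[X] _ (C c)) x y
      = algebraMap k[X] (CompletionIntegers v) X := by
  obtain ⟨x, y, hxy⟩ := h.exists_residue_solution v
  by_cases h1 : 2 * x + C b * y ∈ v.asIdeal
  · have hc : c ≠ 0 := by
      rintro rfl
      have := h.quadNorm_eq_zero (x := b) (y := -1) (by simp [quadNorm]; ring)
      simp at this
    have hcc : C c * C c⁻¹ = (1 : k[X]) := by rw [← C_mul, mul_inv_cancel₀ hc, C_1]
    have h2 : C b * x - 2 * C c * y ∉ v.asIdeal := by
      intro h2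
      have hd := C_not_mem (v := v) h.discr_ne_zero
      have e2 : C (b ^ 2 + 4 * c) = C b ^ 2 + 4 * C c := by
        rw [C_add, C_pow, C_mul, show C (4 : k) = 4 from map_ofNat C 4]
      have hy : C (b ^ 2 + 4 * c) * y ∈ v.asIdeal := by
        have := v.asIdeal.sub_mem (v.asIdeal.mul_mem_left (C b) h1) (v.asIdeal.mul_mem_left 2 h2)
        convert this using 1
        rw [e2]; ring
      have hx : C (b ^ 2 + 4 * c) * x ∈ v.asIdeal := by
        have := v.asIdeal.add_mem (v.asIdeal.mul_mem_left (C b) h2)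
          (v.asIdeal.mul_mem_left (2 * C c) h1)
        convert this using 1
        rw [e2]; ring
      replace hx := (v.isPrime.mem_or_mem hx).resolve_left hd
      replace hy := (v.isPrime.mem_or_mem hy).resolve_left hd
      refine X_not_mem hv ?_
      have := v.asIdeal.sub_mem (v.asIdeal.add_mem (v.asIdeal.mul_mem_left (x + C b * y) hx)
        (v.asIdeal.mul_mem_left (-C c * y) hy)) hxy
      convert this using 1
      simp only [quadNorm]; ring
    -- The equation in y is divided by -c to make it monic.
    obtain ⟨z, hz⟩ := exists_root_of_isUnit_derivative v (-(C c⁻¹ * C b * x))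
      (-(C c⁻¹ * (x ^ 2 - X))) y (by
        have := v.asIdeal.mul_mem_left (-C c⁻¹) hxy
        convert this using 1
        simp only [quadNorm]
        linear_combination (-y ^ 2) * hcc) (fun h3 => h2 (by
        have := v.asIdeal.mul_mem_left (-C c) h3
        convert this using 1
        linear_combination (-C b * x) * hcc))
    refine ⟨algebraMap k[X] _ x, z, ?_⟩
    have e := congrArg (algebraMap k[X] (CompletionIntegers v)) hcc
    simp only [map_mul, map_neg, map_sub, map_pow, map_one] at hz e
    simp only [quadNorm]
    set a := algebraMap k[X] (CompletionIntegers v)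
    linear_combination (-a (C c)) * hz - (a (C b) * a x * z + a x ^ 2 - a X) * e
  · obtain ⟨z, hz⟩ := exists_root_of_isUnit_derivative v (C b * y) (-(C c * y ^ 2 + X)) x (by
      convert hxy using 1
      simp only [quadNorm]; ring) h1
    refine ⟨z, algebraMap k[X] _ y, ?_⟩
    simp only [map_mul, map_neg, map_add, map_pow] at hz
    simp only [quadNorm]
    linear_combination hz

end NormEquation

/-! ### Splitting of the quaternion algebra at unramified places -/

section Splitting

/-- The matrices of `Z` and `F` acting on the quadratic algebra `L ⊕ LZ` by multiplication by `Z`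
and by `w ↦ (x + yZ) w̄`, when `x² + bxy - cy² = t`. -/
def splitBasis {R L : Type*} [CommRing R] [Field L] [Algebra R L] {b c t : R} {x y : L}
    (h : quadNorm (algebraMap R L b) (algebraMap R L c) x y = algebraMap R L t) :
    QuaternionAlgebra.Basis (Matrix (Fin 2) (Fin 2) L) c b t where
  i := !![0, algebraMap R L c; 1, algebraMap R L b]
  j := !![x, algebraMap R L b * x - algebraMap R L c * y; y, -x]
  k := !![0, algebraMap R L c; 1, algebraMap R L b] *
    !![x, algebraMap R L b * x - algebraMap R L c * y; y, -x]
  i_mul_i := by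
    ext i j
    fin_cases i <;> fin_cases j <;> simp [Matrix.mul_apply] <;>
      simp [Algebra.smul_def] <;> ring
  j_mul_j := by
    ext i j
    fin_cases i <;> fin_cases j <;>
      simp [Matrix.mul_apply] <;> (try rw [Algebra.smul_def, ← h, quadNorm]) <;> ring
  i_mul_j := rfl
  j_mul_i := by
    ext i j
    fin_cases i <;> fin_cases j <;>
      simp [Matrix.mul_apply] <;> (try simp only [Algebra.smul_def]) <;> ring

/-- `hp` and `hq` state that the two coordinates of (a₂ + a₃Z)(x + yZ) vanish, which follows from
the nonzero discriminant. Multiplying by the conjugate of x + yZ, of norm t ≠ 0, gives a₂ = a₃ = 0.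
-/
theorem splitBasis_independent {L : Type*} [Field L] {b c t x y : L} (ht : t ≠ 0)
    (hd : b ^ 2 + 4 * c ≠ 0) (h : quadNorm b c x y = t) {a₀ a₁ a₂ a₃ : L}
    (h0 : a₀ • (1 : Matrix (Fin 2) (Fin 2) L) + a₁ • !![0, c; 1, b] +
      a₂ • !![x, b * x - c * y; y, -x] +
      a₃ • (!![0, c; 1, b] * !![x, b * x - c * y; y, -x]) = 0) :
    a₀ = 0 ∧ a₁ = 0 ∧ a₂ = 0 ∧ a₃ = 0 := by
  have e00 := congrFun (congrFun h0 0) 0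
  have e01 := congrFun (congrFun h0 0) 1
  have e10 := congrFun (congrFun h0 1) 0
  have e11 := congrFun (congrFun h0 1) 1
  simp at e00 e01 e10 e11
  have hp : a₂ * x + c * a₃ * y = 0 := by
    refine (mul_eq_zero.1 (?_ : (b ^ 2 + 4 * c) * _ = 0)).resolve_left hd
    linear_combination b * e01 - 2 * c * e11 + 2 * c * e00 - (-b * c) * e10
  have hq : a₂ * y + a₃ * x + b * a₃ * y = 0 := by
    refine (mul_eq_zero.1 (?_ : (b ^ 2 + 4 * c) * _ = 0)).resolve_left hd
    linear_combination -2 * e01 - b * e11 + b * e00 + (2 * c + b ^ 2) * e10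
  have h2 : a₂ = 0 := by
    refine (mul_eq_zero.1 (?_ : t * _ = 0)).resolve_left ht
    rw [← h, quadNorm]
    linear_combination (x + b * y) * hp - c * y * hq
  have h3 : a₃ = 0 := by
    refine (mul_eq_zero.1 (?_ : t * _ = 0)).resolve_left ht
    rw [← h, quadNorm]
    linear_combination x * hq - y * hp
  subst h2 h3
  refine ⟨by simpa using e00, by simpa using e10, rfl, rfl⟩

variable {k : Type*} [Field k] [Fintype k] {b c : k}

/-- A solution of the norm equation gives a representation on K_v². It is injective because the
images of 1, Z, F, ZF are independent, and both algebras have dimension 4. -/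
theorem IsAdmissible.nonempty_localSplitting (h : IsAdmissible b c) {v : HeightOneSpectrum k[X]}
    (hv : Place.finite v ≠ Place.zero k) :
    Nonempty (LocalD b c v ≃ₐ[Completion v] Matrix (Fin 2) (Fin 2) (Completion v)) := by
  obtain ⟨x, y, hxy⟩ := h.exists_quadNorm_eq hv
  have hC : ∀ a : k, algebraMap (RatFunc k) (Completion v) (RatFunc.C a) =
      algebraMap (CompletionIntegers v) (Completion v)
        (algebraMap k[X] (CompletionIntegers v) (C a)) := fun a => by
    rw [coe_algebraMap_completionIntegers, RatFunc.algebraMap_C]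
  have hN : quadNorm (algebraMap (RatFunc k) (Completion v) (RatFunc.C b))
      (algebraMap (RatFunc k) (Completion v) (RatFunc.C c)) x y =
      algebraMap (RatFunc k) (Completion v) RatFunc.X := by
    have := congrArg (algebraMap (CompletionIntegers v) (Completion v)) hxy
    rw [coe_algebraMap_completionIntegers, RatFunc.algebraMap_X] at this
    rw [← this, hC, hC]
    simp only [quadNorm, map_add, map_sub, map_mul, map_pow]
    rfl
  have hX : algebraMap (RatFunc k) (Completion v) RatFunc.X ≠ 0 := by
    simpa using RatFunc.X_ne_zero
  have hd : algebraMap (RatFunc k) (Completion v) (RatFunc.C b) ^ 2 +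
      4 * algebraMap (RatFunc k) (Completion v) (RatFunc.C c) ≠ 0 := by
    have : algebraMap (RatFunc k) (Completion v) (RatFunc.C (b ^ 2 + 4 * c)) ≠ 0 := by
      rw [Ne, map_eq_zero, map_eq_zero]
      exact h.discr_ne_zero
    simpa only [map_add, map_pow, map_mul, map_ofNat] using this
  let φ : LocalD b c v →ₐ[Completion v] Matrix (Fin 2) (Fin 2) (Completion v) :=
    Algebra.TensorProduct.lift (Algebra.ofId _ _) (splitBasis hN).liftHom
      (fun r s => Algebra.commutes r _)
  have hinj : Function.Injective φ := by
    rw [injective_iff_map_eq_zero]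
    intro z hz
    let e := (QuaternionAlgebra.basisOneIJK (RatFunc.C c) (RatFunc.C b)
      (RatFunc.X : RatFunc k)).baseChange (Completion v)
    have hsum := e.sum_repr z
    rw [← hsum, map_sum] at hz
    have he : ∀ i, φ (e i) = (splitBasis hN).liftHom
        (QuaternionAlgebra.basisOneIJK (RatFunc.C c) (RatFunc.C b) (RatFunc.X : RatFunc k) i) := by
      intro i
      rw [Module.Basis.baseChange_apply]
      exact (Algebra.TensorProduct.lift_tmul _ _ _ _ _).trans (by rw [map_one, one_mul])
    simp only [map_smul, he, Fin.sum_univ_four] at hz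
    have key := splitBasis_independent hX hd hN (a₀ := e.repr z 0) (a₁ := e.repr z 1)
      (a₂ := e.repr z 2) (a₃ := e.repr z 3) (by
        convert hz using 4 <;>
        simp [QuaternionAlgebra.Basis.lift, QuaternionAlgebra.basisOneIJK, splitBasis])
    rw [← hsum, Fin.sum_univ_four, key.1, key.2.1, key.2.2.1, key.2.2.2]
    simp
  have hfr : Module.finrank (Completion v) (LocalD b c v) =
      Module.finrank (Completion v) (Matrix (Fin 2) (Fin 2) (Completion v)) := by
    rw [Module.finrank_baseChange, QuaternionAlgebra.finrank_eq_four, Module.finrank_matrix]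
    simp
  exact ⟨AlgEquiv.ofBijective φ ⟨hinj,
    (LinearMap.injective_iff_surjective_of_finrank_eq_finrank (f := φ.toLinearMap) hfr).1 hinj⟩⟩

theorem IsAdmissible.nonempty_splitting (h : IsAdmissible b c) (S : Finset (Place k)) :
    Nonempty (Splitting b c S) :=
  ⟨fun v => (h.nonempty_localSplitting v.2.2).some⟩

end Splitting

/-! ### `S`-integers and `S`-units -/

section SIntegers

open Filter

variable {k : Type*} [Field k] {S : Finset (Place k)}

instance finite_unramifiedPlace : Finite (UnramifiedPlace S) :=
  Finite.of_injective (fun v : UnramifiedPlace S => (⟨.finite v.1, v.2.1⟩ : S))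
    fun _ _ h => Subtype.ext (Place.finite.inj (congrArg Subtype.val h))

theorem valuation_finite (v : HeightOneSpectrum k[X]) (x : RatFunc k) :
    (Place.finite v).valuation x = v.valuation (RatFunc k) x := rfl

/-- A polynomial whose zeros are exactly the unramified places of `S`. -/
def IsSupportedOn (S : Finset (Place k)) (f : k[X]) : Prop :=
  f ≠ 0 ∧ ∀ w : HeightOneSpectrum k[X],
    f ∈ w.asIdeal ↔ (Place.finite w ∈ S ∧ Place.finite w ≠ Place.zero k)

/-- A generator of the maximal ideal of a finite place. -/
def placeGenerator (v : HeightOneSpectrum k[X]) : k[X] := Submodule.IsPrincipal.generator v.asIdeal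

theorem span_placeGenerator (v : HeightOneSpectrum k[X]) :
    v.asIdeal = Ideal.span {placeGenerator v} := (Ideal.span_singleton_generator _).symm

theorem placeGenerator_ne_zero (v : HeightOneSpectrum k[X]) : placeGenerator v ≠ 0 := fun h =>
  v.ne_bot ((Submodule.IsPrincipal.eq_bot_iff_generator_eq_zero _).2 h)

theorem placeGenerator_mem_iff {v w : HeightOneSpectrum k[X]} :
    placeGenerator v ∈ w.asIdeal ↔ v = w := by
  constructor
  · intro h
    have hle : v.asIdeal ≤ w.asIdeal := by
      rw [span_placeGenerator v, Ideal.span_singleton_le_iff_mem]; exact h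
    exact HeightOneSpectrum.ext (v.isMaximal.eq_of_le w.isPrime.ne_top hle)
  · rintro rfl
    rw [span_placeGenerator v]
    exact Ideal.mem_span_singleton_self _

theorem valuation_eq_one_of_not_mem {w : HeightOneSpectrum k[X]} {p : k[X]} (h : p ∉ w.asIdeal) :
    w.valuation (RatFunc k) (algebraMap k[X] (RatFunc k) p) = 1 := by
  rw [w.valuation_of_algebraMap]
  exact le_antisymm (w.intValuation_le_one _)
    (not_lt.1 fun hlt => h ((w.intValuation_lt_one_iff_mem _).1 hlt))

theorem valuation_placeGenerator_self (v : HeightOneSpectrum k[X]) :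
    v.valuation (RatFunc k) (algebraMap k[X] (RatFunc k) (placeGenerator v)) =
      WithZero.exp (-1 : ℤ) := by
  rw [v.valuation_of_algebraMap]
  exact v.intValuation_singleton (placeGenerator_ne_zero v) (span_placeGenerator v)

variable (S) in
theorem exists_isSupportedOn : ∃ f : k[X], IsSupportedOn S f := by
  have := Fintype.ofFinite (UnramifiedPlace S)
  refine ⟨∏ v : UnramifiedPlace S, placeGenerator v.1, ?_, fun w => ?_⟩
  · exact Finset.prod_ne_zero_iff.2 fun v _ => placeGenerator_ne_zero v.1
  · rw [w.isPrime.prod_mem_iff]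
    constructor
    · rintro ⟨v, -, hv⟩
      rw [placeGenerator_mem_iff] at hv
      exact hv ▸ v.2
    · intro h
      exact ⟨⟨w, h⟩, Finset.mem_univ _, placeGenerator_mem_iff.2 rfl⟩

theorem poly_mem_sIntegers (hinf : Place.infinity ∈ S) (p : k[X]) :
    algebraMap k[X] (RatFunc k) p ∈ sIntegers S := by
  intro v hv
  cases v with
  | finite v => exact v.valuation_le_one p
  | infinity => exact absurd hinf hv

theorem inv_poly_mem_sIntegers (hinf : Place.infinity ∈ S) {p : k[X]}
    (hp : ∀ w : HeightOneSpectrum k[X], Place.finite w ∉ S → p ∉ w.asIdeal) :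
    (algebraMap k[X] (RatFunc k) p)⁻¹ ∈ sIntegers S := by
  intro v hv
  cases v with
  | finite v =>
    rw [valuation_finite, map_inv₀, valuation_eq_one_of_not_mem (hp v hv), inv_one]
  | infinity => exact absurd hinf hv

theorem IsSupportedOn.not_mem {f : k[X]} (hf : IsSupportedOn S f) {w : HeightOneSpectrum k[X]}
    (hw : Place.finite w ∉ S) (n : ℕ) : f ^ n ∉ w.asIdeal := fun h =>
  hw ((hf.2 w).1 (w.isPrime.mem_of_pow_mem n h)).1

/-- Multiplication by high powers of an element of the prime kills the poles. -/
theorem eventually_valuation_le_one (w : HeightOneSpectrum k[X]) {p : k[X]} (hp : p ∈ w.asIdeal)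
    (x : RatFunc k) :
    ∀ᶠ n in atTop, w.valuation (RatFunc k) (algebraMap k[X] (RatFunc k) p ^ n * x) ≤ 1 := by
  obtain ⟨n, y, hy⟩ := isAbsorbing_poly hp (algebraMap (RatFunc k) (Completion w) x)
  filter_upwards [eventually_ge_atTop n] with m hm
  obtain ⟨i, rfl⟩ := Nat.exists_eq_add_of_le hm
  rw [add_comm, pow_add, mul_assoc, map_mul]
  refine mul_le_one' ?_ ?_
  · rw [← map_pow]; exact w.valuation_le_one _
  · rw [← valued_algebraMap, map_mul, map_pow, ← coe_algebraMap_completionIntegers, ← hy]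
    exact y.2

theorem IsSupportedOn.eventually_isPoly {f : k[X]} (hf : IsSupportedOn S f) {x : RatFunc k}
    (hx : x ∈ sIntegers S) :
    ∀ᶠ n in atTop, ∃ p, algebraMap k[X] (RatFunc k) p =
      algebraMap k[X] (RatFunc k) ((X * f) ^ n) * x := by
  have h : ∀ᶠ n in atTop, ∀ w : Place k, w ∈ S → ∀ v, w = .finite v →
      v.valuation (RatFunc k) (algebraMap k[X] (RatFunc k) (X * f) ^ n * x) ≤ 1 := by
    refine (eventually_all_finset S).2 fun w hw => ?_
    cases w with
    | infinity => exact Eventually.of_forall fun n v hv => by cases hv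
    | finite v =>
      have hmem : X * f ∈ v.asIdeal := by
        by_cases h : Place.finite v = Place.zero k
        · obtain rfl := Place.finite.inj h
          refine Ideal.mul_mem_right _ _ ?_
          rw [Polynomial.idealX_span]; exact Ideal.mem_span_singleton_self _
        · exact Ideal.mul_mem_left _ _ ((hf.2 v).2 ⟨hw, h⟩)
      filter_upwards [eventually_valuation_le_one v hmem x] with n hn v' hv'
      obtain rfl := Place.finite.inj hv'
      exact hn
  filter_upwards [h] with n hn
  refine HeightOneSpectrum.mem_integers_of_valuation_le_one (R := k[X]) (RatFunc k) _ fun v => ?_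
  by_cases hv : Place.finite v ∈ S
  · rw [map_pow]; exact hn _ hv v rfl
  · rw [map_mul]
    exact mul_le_one' (v.valuation_le_one _) (hx _ hv)

theorem IsSupportedOn.isPoly_of_valuation_le_one {f : k[X]} (hf : IsSupportedOn S f) {x : RatFunc k}
    {m : ℕ} {p : k[X]}
    (hp : algebraMap k[X] (RatFunc k) p = algebraMap k[X] (RatFunc k) f ^ m * x)
    (hx : ∀ v : UnramifiedPlace S, v.1.valuation (RatFunc k) x ≤ 1) :
    ∃ p', algebraMap k[X] (RatFunc k) p' = x := by
  refine HeightOneSpectrum.mem_integers_of_valuation_le_one (R := k[X]) (RatFunc k) _ fun v => ?_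
  by_cases hv : Place.finite v ∈ S ∧ Place.finite v ≠ Place.zero k
  · exact hx ⟨v, hv⟩
  · rw [← hf.2] at hv
    have h1 : v.valuation (RatFunc k) (algebraMap k[X] (RatFunc k) p) ≤ 1 := v.valuation_le_one p
    rwa [hp, map_mul, map_pow, valuation_eq_one_of_not_mem hv, one_pow, one_mul] at h1

/-- There are `S`-units with prescribed valuations at the unramified places of `S`. -/
theorem exists_sUnit (hinf : Place.infinity ∈ S) (u : ∀ v : UnramifiedPlace S, (Completion v.1)ˣ) :
    ∃ s : (RatFunc k)ˣ, (s : RatFunc k) ∈ sIntegers S ∧ ((s⁻¹ : (RatFunc k)ˣ) : RatFunc k) ∈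
      sIntegers S ∧ ∀ v : UnramifiedPlace S,
        v.1.valuation (RatFunc k) s = Valued.v (u v : Completion v.1) := by
  classical
  have := Fintype.ofFinite (UnramifiedPlace S)
  have hn : ∀ v : UnramifiedPlace S, ∃ n : ℤ,
      (WithZero.exp (-1 : ℤ)) ^ n = Valued.v (u v : Completion v.1) := by
    intro v
    have h0 : Valued.v (u v : Completion v.1) ≠ 0 := (Valuation.ne_zero_iff _).2 (u v).ne_zero
    generalize Valued.v (u v : Completion v.1) = z at h0
    induction z using WithZero.expRecOn with
    | zero => exact absurd rfl h0
    | exp e => exact ⟨-e, by rw [← WithZero.exp_zsmul]; simp⟩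
  choose n hn using hn
  let π : UnramifiedPlace S → (RatFunc k)ˣ := fun v =>
    Units.mk0 (algebraMap k[X] (RatFunc k) (placeGenerator v.1))
      (by simpa using placeGenerator_ne_zero v.1)
  have hval : ∀ (m : UnramifiedPlace S → ℤ) (w : HeightOneSpectrum k[X]),
      w.valuation (RatFunc k) ((∏ v, π v ^ m v : (RatFunc k)ˣ) : RatFunc k) =
        ∏ v, w.valuation (RatFunc k) (algebraMap k[X] (RatFunc k) (placeGenerator v.1)) ^ m v := by
    intro m w
    rw [Units.coe_prod, map_prod]
    refine Finset.prod_congr rfl fun v _ => ?_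
    rw [Units.val_zpow_eq_zpow_val, map_zpow₀]
    rfl
  have hout : ∀ m : UnramifiedPlace S → ℤ,
      ((∏ v, π v ^ m v : (RatFunc k)ˣ) : RatFunc k) ∈ sIntegers S := by
    intro m w hw
    cases w with
    | infinity => exact absurd hinf hw
    | finite w =>
      rw [valuation_finite, hval]
      refine (Finset.prod_eq_one fun v _ => ?_).le
      have hvw : placeGenerator v.1 ∉ w.asIdeal := fun h => hw (placeGenerator_mem_iff.1 h ▸ v.2.1)
      rw [valuation_eq_one_of_not_mem hvw, one_zpow]
  refine ⟨∏ v, π v ^ n v, hout n, ?_, fun w => ?_⟩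
  · rw [← Finset.prod_inv_distrib]
    simp_rw [← zpow_neg]
    exact hout (-n)
  · rw [hval, Finset.prod_eq_single w, valuation_placeGenerator_self, hn]
    · intro v _ hvw
      have hvw' : placeGenerator v.1 ∉ w.1.asIdeal := fun h =>
        hvw (Subtype.ext (placeGenerator_mem_iff.1 h))
      rw [valuation_eq_one_of_not_mem hvw', one_zpow]
    · exact fun h => absurd (Finset.mem_univ _) h

end SIntegers

/-! ### The polynomial order inside the quaternion algebra -/

section ToD

variable {k : Type*} [Field k] {b c : k} {S : Finset (Place k)}

/-- The coordinates of a quaternion. -/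
def coord {R : Type*} {a b c : R} (x : QuaternionAlgebra R a b c) : Fin 4 → R :=
  QuaternionAlgebra.equivTuple a b c x

/-- The inclusion of the polynomial order into the quaternion algebra. -/
def toD (b c : k) : PolyOrder b c →+* D b c where
  toFun x := ⟨algebraMap _ _ x.re, algebraMap _ _ x.imI, algebraMap _ _ x.imJ, algebraMap _ _ x.imK⟩
  map_one' := by ext <;> simp
  map_zero' := by ext <;> simp
  map_add' x y := by ext <;> simp
  map_mul' x y := by ext <;> simp

theorem coord_toD (x : PolyOrder b c) (i : Fin 4) :
    coord (toD b c x) i = algebraMap k[X] (RatFunc k) (coord x i) := by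
  fin_cases i <;> rfl

theorem coord_ext {R : Type*} {a b c : R} {x y : QuaternionAlgebra R a b c}
    (h : ∀ i, coord x i = coord y i) : x = y :=
  (QuaternionAlgebra.equivTuple a b c).injective (funext h)

theorem coord_smul {R T : Type*} [CommRing R] [SMul T R] {a b c : R} (t : T)
    (x : QuaternionAlgebra R a b c) (i : Fin 4) : coord (t • x) i = t • coord x i := by
  fin_cases i <;> rfl

theorem toD_injective : Function.Injective (toD b c) := fun x y h => coord_ext fun i => by
  have := congrArg (coord · i) h
  simpa [coord_toD] using this

theorem exists_toD_eq {x : D b c}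
    (h : ∀ i, ∃ p, algebraMap k[X] (RatFunc k) p = coord x i) : ∃ y, toD b c y = x := by
  choose p hp using h
  refine ⟨(QuaternionAlgebra.equivTuple (C c) (C b) X).symm p, coord_ext fun i => ?_⟩
  rw [coord_toD, ← hp]
  congr 1
  exact congrFun ((QuaternionAlgebra.equivTuple (C c) (C b) X).apply_symm_apply p) i

theorem toD_coe (p : k[X]) : toD b c (QuaternionAlgebra.coe p) =
    algebraMap (RatFunc k) (D b c) (algebraMap k[X] (RatFunc k) p) := by
  ext <;> simp [toD, QuaternionAlgebra.algebraMap_eq]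

theorem mem_orderSections_iff (hinf : Place.infinity ∈ S) {x : D b c} :
    x ∈ orderSections b c S ↔ ∀ i, coord x i ∈ sIntegers S := by
  have hv : ∀ y, y ∈ sIntegersVanishing S ↔ y ∈ sIntegers S := fun y =>
    ⟨fun h => h.1, fun h => ⟨h, fun h' => absurd hinf h'⟩⟩
  simp only [Fin.forall_fin_succ, Fin.forall_fin_zero, and_true]
  change (_ ∧ _ ∧ x.imJ ∈ sIntegersVanishing S ∧ x.imK ∈ sIntegersVanishing S) ↔ _
  rw [hv, hv]
  rfl

theorem toD_mem_orderSections (hinf : Place.infinity ∈ S) (x : PolyOrder b c) :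
    toD b c x ∈ orderSections b c S :=
  (mem_orderSections_iff hinf).2 fun i => coord_toD x i ▸ poly_mem_sIntegers hinf _

theorem smul_mem_orderSections {s : RatFunc k} (hs : s ∈ sIntegers S) {x : D b c}
    (hx : x ∈ orderSections b c S) : s • x ∈ orderSections b c S :=
  ⟨mul_mem hs hx.1, mul_mem hs hx.2.1, mul_mem_vanishing hs hx.2.2.1, mul_mem_vanishing hs hx.2.2.2⟩

/-- An element of the polynomial order with an inverse up to the `S`-unit `d` is a unit of the ring
of sections away from `S`. -/
def sectionUnit (hinf : Place.infinity ∈ S) {x y : PolyOrder b c} {d : k[X]}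
    (hd0 : d ≠ 0) (hd : ∀ w : HeightOneSpectrum k[X], Place.finite w ∉ S → d ∉ w.asIdeal)
    (hxy : x * y = QuaternionAlgebra.coe d) (hyx : y * x = QuaternionAlgebra.coe d) :
    (orderSections b c S)ˣ where
  val := ⟨toD b c x, toD_mem_orderSections hinf x⟩
  inv := ⟨(algebraMap k[X] (RatFunc k) d)⁻¹ • toD b c y,
    smul_mem_orderSections (inv_poly_mem_sIntegers hinf hd) (toD_mem_orderSections hinf y)⟩
  val_inv := Subtype.ext <| by
    change toD b c x * _ • toD b c y = 1
    rw [mul_smul_comm, ← map_mul, hxy, toD_coe, Algebra.algebraMap_eq_smul_one (A := D b c), smul_smul,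
      inv_mul_cancel₀ (by simpa using hd0), one_smul]
  inv_val := Subtype.ext <| by
    change (_ • toD b c y) * toD b c x = 1
    rw [smul_mul_assoc, ← map_mul, hyx, toD_coe, Algebra.algebraMap_eq_smul_one (A := D b c), smul_smul,
      inv_mul_cancel₀ (by simpa using hd0), one_smul]

end ToD

/-! ### Localisation of the quaternion algebra -/

section Localisation

open Filter

variable {k : Type*} [Field k] {b c : k} {S : Finset (Place k)} (φ : Splitting b c S)
  (v : UnramifiedPlace S)

/-- The representation of `D` on `K_v²`. -/
def localRep : D b c →+* Matrix (Fin 2) (Fin 2) (Completion v.1) :=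
  ((φ v).toRingEquiv.toRingHom).comp
    (Algebra.TensorProduct.includeRight : D b c →ₐ[RatFunc k] LocalD b c v.1).toRingHom

/-- The images of `1, Z, F, ZF` as a basis of the matrix algebra. -/
def localBasis : Module.Basis (Fin 4) (Completion v.1)
    (Matrix (Fin 2) (Fin 2) (Completion v.1)) :=
  ((QuaternionAlgebra.basisOneIJK (RatFunc.C c) (RatFunc.C b)
    (RatFunc.X : RatFunc k)).baseChange (Completion v.1)).map (φ v).toLinearEquiv

theorem localBasis_repr (x : D b c) (i : Fin 4) :
    (localBasis φ v).repr (localRep φ v x) i =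
      algebraMap (RatFunc k) (Completion v.1) (coord x i) := by
  have h : (localBasis φ v).repr (localRep φ v x) =
      ((QuaternionAlgebra.basisOneIJK (RatFunc.C c) (RatFunc.C b)
        (RatFunc.X : RatFunc k)).baseChange (Completion v.1)).repr (1 ⊗ₜ x) := by
    change ((QuaternionAlgebra.basisOneIJK (RatFunc.C c) (RatFunc.C b)
        (RatFunc.X : RatFunc k)).baseChange (Completion v.1)).repr
          ((φ v).symm ((φ v) (1 ⊗ₜ x))) = _
    rw [AlgEquiv.symm_apply_apply]
  rw [h]
  refine (Module.Basis.baseChange_repr_tmul _ _ _ _ _).trans ?_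
  rw [Algebra.algebraMap_eq_smul_one]
  rfl

theorem localRep_eq_sum (x : D b c) :
    localRep φ v x =
      ∑ i, algebraMap (RatFunc k) (Completion v.1) (coord x i) • localBasis φ v i := by
  rw [← (localBasis φ v).sum_repr (localRep φ v x)]
  simp only [localBasis_repr]

variable (b c) in
/-- The basis `1, Z, F, ZF` of the polynomial order. -/
def polyBasis (i : Fin 4) : PolyOrder b c :=
  QuaternionAlgebra.basisOneIJK (C c) (C b) X i

theorem coord_polyBasis (i j : Fin 4) :
    coord (polyBasis b c i) j = if i = j then 1 else 0 := by
  have := (QuaternionAlgebra.basisOneIJK (C c) (C b) (X : k[X])).repr_self_apply i j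
  rw [← this]; rfl

theorem localBasis_eq (i : Fin 4) : localBasis φ v i = localRep φ v (toD b c (polyBasis b c i)) := by
  refine (localBasis φ v).repr.injective (Finsupp.ext fun j => ?_)
  rw [localBasis_repr, Module.Basis.repr_self_apply, coord_toD, coord_polyBasis]
  split_ifs <;> simp

/-- A lattice of `K_v²` stable under the polynomial order. -/
def localLattice : Submodule (CompletionIntegers v.1) (Fin 2 → Completion v.1) :=
  orbitLattice (localBasis φ v)

instance isLattice_localLattice : (localLattice φ v).IsLattice (Completion v.1) := by
  refine isLattice_orbitLattice ?_
  rw [localBasis_eq, show polyBasis b c 0 = 1 from ?_, map_one, map_one]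
  refine coord_ext fun j => ?_
  rw [coord_polyBasis]
  fin_cases j <;> rfl

theorem translate_localBasis_le (i : Fin 4) :
    translate (localBasis φ v i) (localLattice φ v) ≤ localLattice φ v := by
  refine translate_orbitLattice_le (fun i j => ?_) i
  refine ⟨fun l => algebraMap k[X] _ (coord (polyBasis b c i * polyBasis b c j) l), ?_⟩
  rw [localBasis_eq, localBasis_eq, ← map_mul, ← map_mul, localRep_eq_sum]
  simp only [coord_toD, coe_algebraMap_completionIntegers]

variable {v} in
theorem translate_localRep_le {x : D b c}
    (hx : ∀ i, v.1.valuation (RatFunc k) (coord x i) ≤ 1) :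
    translate (localRep φ v x) (localLattice φ v) ≤ localLattice φ v := by
  refine translate_le.2 fun m hm => ?_
  rw [localRep_eq_sum, Matrix.sum_mulVec]
  refine Submodule.sum_mem _ fun i _ => ?_
  have h : Valued.v (algebraMap (RatFunc k) (Completion v.1) (coord x i)) ≤ 1 := by
    rw [valued_algebraMap]; exact hx i
  rw [Matrix.smul_mulVec]
  exact Submodule.smul_mem _ (⟨_, h⟩ : CompletionIntegers v.1)
    (translate_le.1 (translate_localBasis_le φ v i) m hm)

theorem translate_toD_le (x : PolyOrder b c) :
    translate (localRep φ v (toD b c x)) (localLattice φ v) ≤ localLattice φ v :=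
  translate_localRep_le φ fun i => coord_toD x i ▸ v.1.valuation_le_one _

theorem localRep_algebraMap (r : RatFunc k) :
    localRep φ v (algebraMap (RatFunc k) (D b c) r) =
      algebraMap (RatFunc k) (Completion v.1) r • (1 : Matrix (Fin 2) (Fin 2) _) := by
  change φ v ((1 : Completion v.1) ⊗ₜ[RatFunc k] algebraMap (RatFunc k) (D b c) r) = _
  have h2 : (1 : Completion v.1) ⊗ₜ[RatFunc k] algebraMap (RatFunc k) (D b c) r
      = algebraMap (Completion v.1) (LocalD b c v.1)
        (algebraMap (RatFunc k) (Completion v.1) r) := by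
    rw [Algebra.algebraMap_eq_smul_one, TensorProduct.tmul_smul, TensorProduct.smul_tmul',
      ← Algebra.algebraMap_eq_smul_one]
    rfl
  rw [h2, AlgEquiv.commutes, Algebra.algebraMap_eq_smul_one]

theorem localRep_smul (r : RatFunc k) (x : D b c) :
    localRep φ v (r • x) = algebraMap (RatFunc k) (Completion v.1) r • localRep φ v x := by
  rw [Algebra.smul_def, map_mul, localRep_algebraMap, smul_mul_assoc, one_mul]

theorem localRep_toD_coe (p : k[X]) (w : Fin 2 → Completion v.1) :
    (localRep φ v (toD b c (QuaternionAlgebra.coe p))).mulVec w =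
      algebraMap k[X] (CompletionIntegers v.1) p • w := by
  rw [toD_coe, localRep_algebraMap, Matrix.smul_mulVec, Matrix.one_mulVec,
    ← algebraMap_smul (Completion v.1) (algebraMap k[X] (CompletionIntegers v.1) p)]
  rfl

/-! ### Transitivity -/

theorem translate_scalarGL {O K : Type*} [CommRing O] [Field K] [Algebra O K] (u : Kˣ)
    (y : Matrix (Fin 2) (Fin 2) K) (M : Submodule O (Fin 2 → K)) :
    translate (scalarGL u).1 (translate y M) = translate ((u : K) • y) M := by
  rw [← translate_mul]
  congr 1
  change Matrix.scalar (Fin 2) (u : K) * y = _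
  rw [Matrix.scalar_apply, Matrix.smul_eq_diagonal_mul]

/-- Up to homothety, every family of lattices is a translate of the standard one by an element of
the polynomial order. -/
theorem exists_translate_eq_scalar
    (L : ∀ v : UnramifiedPlace S, Submodule (CompletionIntegers v.1) (Fin 2 → Completion v.1))
    (hL : ∀ v, (L v).IsLattice (Completion v.1)) :
    ∃ (u : ∀ v : UnramifiedPlace S, (Completion v.1)ˣ) (x : PolyOrder b c), ∀ v,
      translate (localRep φ v (toD b c x)) (localLattice φ v) =
        translate (scalarGL (u v)).1 (L v) := by
  obtain ⟨f, hf⟩ := exists_isSupportedOn S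
  have hfv : ∀ v : UnramifiedPlace S, f ∈ v.1.asIdeal := fun v => (hf.2 v.1).2 v.2
  have hF : ∀ v : UnramifiedPlace S, algebraMap (CompletionIntegers v.1) (Completion v.1)
      (algebraMap k[X] (CompletionIntegers v.1) f) ≠ 0 := fun v => by
    rw [coe_algebraMap_completionIntegers]
    simpa using hf.1
  choose y hy using fun v => exists_translate_eq (K := Completion v.1) (localLattice φ v) (L v)
  have hn : ∀ v : UnramifiedPlace S, ∃ n : ℕ, ∀ i, ∃ a : CompletionIntegers v.1,
      algebraMap _ (Completion v.1) a = algebraMap _ (Completion v.1)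
        (algebraMap k[X] (CompletionIntegers v.1) f) ^ n * (localBasis φ v).repr (y v) i := by
    intro v
    choose n z hz using fun i => isAbsorbing_poly (hfv v) ((localBasis φ v).repr (y v) i)
    -- The sum of the four exponents clears every coordinate; the surplus powers of f go into the
    -- integer.
    refine ⟨∑ i, n i, fun i => ⟨algebraMap k[X] _ f ^ (∑ j ∈ Finset.univ.erase i, n j) * z i, ?_⟩⟩
    rw [map_mul, hz, map_pow, ← mul_assoc, ← pow_add, Finset.sum_erase_add _ _ (Finset.mem_univ i)]
  choose n a ha using hn
  let u : ∀ v : UnramifiedPlace S, (Completion v.1)ˣ := fun v => Units.mk0 _ (hF v) ^ n v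
  have hL' : ∀ v, translate (∑ i, algebraMap _ (Completion v.1) (a v i) • localBasis φ v i)
      (localLattice φ v) = translate (scalarGL (u v)).1 (L v) := by
    intro v
    rw [← hy, translate_scalarGL]
    congr 1
    rw [← (localBasis φ v).sum_repr (y v), Finset.smul_sum]
    refine Finset.sum_congr rfl fun i _ => ?_
    rw [ha, smul_smul]
    simp [u]
  have hlat : ∀ v, (translate (scalarGL (u v)).1 (L v)).IsLattice (Completion v.1) :=
    fun v => isLattice_translate _ _ (hL v)
  obtain ⟨m, hm⟩ := (eventually_all.2 fun v => (isAbsorbing_poly (hfv v)).eventually_le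
    (hlat v).span_eq_top (isLattice_localLattice φ v).fg).exists
  -- Each coordinate is approximated modulo f^(m+1), where f^m carries the standard lattices into
  -- the targets.
  choose p hp using fun i => exists_poly_approx (fun v : UnramifiedPlace S => v.1)
    Subtype.val_injective f hf.1 (m + 1) (fun v => a v i)
  refine ⟨u, (QuaternionAlgebra.equivTuple (C c) (C b) X).symm p, fun v => ?_⟩
  rw [localRep_eq_sum]
  refine translate_eq_of_coord_sub (poly_mem_maximalIdeal (hfv v)) (hlat v).fg
    (translate_localBasis_le φ v) (hm v) (hL' v) fun i => ?_
  obtain ⟨e, he⟩ := hp i v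
  refine ⟨e, ?_⟩
  rw [← he, coord_toD, map_sub, coe_algebraMap_completionIntegers]
  congr 3
  exact congrFun ((QuaternionAlgebra.equivTuple (C c) (C b) X).apply_symm_apply p) i

variable (han : ∀ x y : k, quadNorm b c x y = 0 → x = 0 ∧ y = 0)
include han

/-- x(yx) = dx = xd, and x can be cancelled. -/
theorem PolyOrder.mul_comm_of_mul_eq_coe {x y : PolyOrder b c} {d : k[X]} (hd : d ≠ 0)
    (h : x * y = QuaternionAlgebra.coe d) : y * x = QuaternionAlgebra.coe d := by
  have hx : x ≠ 0 := by
    rintro rfl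
    rw [zero_mul] at h
    exact hd (congrArg QuaternionAlgebra.re h).symm
  refine mul_left_cancel han hx ?_
  rw [← mul_assoc, h, QuaternionAlgebra.coe_commutes]

/-- Elements of the polynomial order carrying the standard lattices to given ones may be chosen to
be units away from `S`. -/
theorem exists_unit_translate_eq {f : k[X]} (hf : IsSupportedOn S f) (x : PolyOrder b c)
    (L : ∀ v : UnramifiedPlace S, Submodule (CompletionIntegers v.1) (Fin 2 → Completion v.1))
    (hL : ∀ v, (L v).IsLattice (Completion v.1))
    (hx : ∀ v, translate (localRep φ v (toD b c x)) (localLattice φ v) = L v) :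
    ∃ (n : ℕ) (g r : PolyOrder b c), g * r = QuaternionAlgebra.coe (f ^ n) ∧
      ∀ v, translate (localRep φ v (toD b c g)) (localLattice φ v) = L v := by
  have hfv : ∀ v : UnramifiedPlace S, f ∈ v.1.asIdeal := fun v => (hf.2 v.1).2 v.2
  -- The right ideal of elements carrying each standard lattice into L_v. It contains a power of f,
  -- which its generator must divide.
  let I : AddSubgroup (PolyOrder b c) :=
    { carrier := {h | ∀ v, ∀ m ∈ localLattice φ v, (localRep φ v (toD b c h)).mulVec m ∈ L v}
      zero_mem' := fun v m _ => by simp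
      add_mem' := fun ha hb v m hm => by
        rw [map_add, map_add, Matrix.add_mulVec]; exact (L v).add_mem (ha v m hm) (hb v m hm)
      neg_mem' := fun ha v m hm => by
        rw [map_neg, map_neg, Matrix.neg_mulVec]; exact (L v).neg_mem (ha v m hm) }
  have hI : ∀ h ∈ I, ∀ r, h * r ∈ I := fun h hh r v m hm => by
    rw [map_mul, map_mul, ← Matrix.mulVec_mulVec]
    exact hh v _ (translate_le.1 (translate_toD_le φ v r) m hm)
  obtain ⟨n, hn⟩ := (eventually_all.2 fun v => (isAbsorbing_poly (hfv v)).eventually_le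
    (hL v).span_eq_top (isLattice_localLattice φ v).fg).exists
  have hfI : QuaternionAlgebra.coe (f ^ n) ∈ I := fun v m hm => by
    rw [localRep_toD_coe, map_pow]; exact hn v m hm
  have hf0 : (QuaternionAlgebra.coe (f ^ n) : PolyOrder b c) ≠ 0 := fun h =>
    pow_ne_zero n hf.1 (congrArg QuaternionAlgebra.re h)
  obtain ⟨g, hgI, -, hg⟩ := PolyOrder.exists_generator han I hI hfI hf0
  obtain ⟨r, hr⟩ := hg _ hfI
  refine ⟨n, g, r, hr.symm, fun v => le_antisymm (translate_le.2 (hgI v)) ?_⟩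
  -- As x = gs and s preserves the standard lattices, L_v = xM_v ⊆ gM_v.
  obtain ⟨s, hs⟩ := hg x fun v => translate_le.1 (hx v).le
  rw [← hx v, hs, map_mul, map_mul, translate_mul]
  exact Submodule.map_mono (translate_toD_le φ v s)

/-- The polynomial order is the full stabiliser of the standard lattices. -/
theorem exists_toD_eq_of_translate_le {f : k[X]} (hf : IsSupportedOn S f) {x : D b c} {m : ℕ}
    {h : PolyOrder b c} (hx : algebraMap k[X] (RatFunc k) (f ^ m) • x = toD b c h)
    (hst : ∀ v, translate (localRep φ v x) (localLattice φ v) ≤ localLattice φ v) :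
    ∃ y, toD b c y = x := by
  have hfv : ∀ v : UnramifiedPlace S, f ∈ v.1.asIdeal := fun v => (hf.2 v.1).2 v.2
  have hf0 : ∀ n, algebraMap k[X] (RatFunc k) (f ^ n) ≠ 0 := fun n => by
    simpa using fun h => absurd h hf.1
  -- One exponent N bounds the coordinate denominators of all endomorphisms of the lattices, at all
  -- places at once.
  obtain ⟨N, hN⟩ := (eventually_all.2 fun v => (isAbsorbing_poly (hfv v)).exists_pow_mul_repr
    (localBasis φ v) (localLattice φ v)).exists
  have hbound : ∀ (z : D b c) (m : ℕ) (h : PolyOrder b c),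
      algebraMap k[X] (RatFunc k) (f ^ m) • z = toD b c h →
      (∀ v, translate (localRep φ v z) (localLattice φ v) ≤ localLattice φ v) →
      ∃ y, toD b c y = algebraMap k[X] (RatFunc k) (f ^ N) • z := by
    intro z m h hz hst
    refine exists_toD_eq fun i => ?_
    refine hf.isPoly_of_valuation_le_one (m := m) (p := f ^ N * coord h i) ?_ fun v => ?_
    · rw [map_mul, ← coord_toD, ← hz, coord_smul, coord_smul, smul_eq_mul, smul_eq_mul, map_pow,
        map_pow]
      ring
    · obtain ⟨a, ha⟩ := hN v _ (hst v) i
      rw [coord_smul, smul_eq_mul, ← valued_algebraMap, map_mul, ← localBasis_repr φ, map_pow,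
        map_pow]
      rw [coe_algebraMap_completionIntegers] at ha
      rw [← ha]
      exact a.2
  -- J consists of the h for which f^(-N)h preserves the lattices. It is a right ideal gH; with γ =
  -- f^(-N)g, the lattice-preserving elements with f-power denominators all lie in γH, and γ is one
  -- of them.
  let J : AddSubgroup (PolyOrder b c) :=
    { carrier := {h | ∀ v, ∀ m ∈ localLattice φ v, (localRep φ v
        ((algebraMap k[X] (RatFunc k) (f ^ N))⁻¹ • toD b c h)).mulVec m ∈ localLattice φ v}
      zero_mem' := fun v m _ => by simp
      add_mem' := fun ha hb v m hm => by
        rw [map_add, smul_add, map_add, Matrix.add_mulVec]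
        exact Submodule.add_mem _ (ha v m hm) (hb v m hm)
      neg_mem' := fun ha v m hm => by
        rw [map_neg, smul_neg, map_neg, Matrix.neg_mulVec]
        exact Submodule.neg_mem _ (ha v m hm) }
  have hJ : ∀ h ∈ J, ∀ r, h * r ∈ J := fun h hh r v m hm => by
    rw [map_mul, ← smul_mul_assoc, map_mul, ← Matrix.mulVec_mulVec]
    exact hh v _ (translate_le.1 (translate_toD_le φ v r) m hm)
  have hfJ : QuaternionAlgebra.coe (f ^ N) ∈ J := fun v m hm => by
    rw [toD_coe, Algebra.algebraMap_eq_smul_one (A := D b c), smul_smul, inv_mul_cancel₀ (hf0 N),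
      one_smul, map_one, Matrix.one_mulVec]
    exact hm
  obtain ⟨g, hgJ, hg0, hg⟩ := PolyOrder.exists_generator han J hJ hfJ fun h =>
    pow_ne_zero N hf.1 (congrArg QuaternionAlgebra.re h)
  obtain ⟨γ, hγ⟩ : ∃ γ, γ = (algebraMap k[X] (RatFunc k) (f ^ N))⁻¹ • toD b c g := ⟨_, rfl⟩
  have hγg : algebraMap k[X] (RatFunc k) (f ^ N) • γ = toD b c g := by
    rw [hγ, smul_smul, mul_inv_cancel₀ (hf0 N), one_smul]
  have hmem : ∀ (z : D b c) (y : PolyOrder b c),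
      toD b c y = algebraMap k[X] (RatFunc k) (f ^ N) • z →
      (∀ v, translate (localRep φ v z) (localLattice φ v) ≤ localLattice φ v) → y ∈ J := by
    intro z y hy hz v m hm
    rw [hy, smul_smul, inv_mul_cancel₀ (hf0 N), one_smul]
    exact translate_le.1 (hz v) m hm
  have hγst : ∀ v, translate (localRep φ v γ) (localLattice φ v) ≤ localLattice φ v :=
    fun v => translate_le.2 (hγ ▸ hgJ v)
  -- γ² also preserves the lattices, so γ² ∈ γH; cancelling γ gives γ ∈ H. Then x ∈ γH ⊆ H.
  obtain ⟨w, hw⟩ : ∃ w, toD b c w = γ := by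
    have hγγ : ∀ v, translate (localRep φ v (γ * γ)) (localLattice φ v) ≤ localLattice φ v := by
      intro v
      rw [map_mul, translate_mul]
      exact (Submodule.map_mono (hγst v)).trans (hγst v)
    have e : algebraMap k[X] (RatFunc k) (f ^ (N + N)) • (γ * γ) = toD b c (g * g) := by
      rw [map_mul (toD b c), ← hγg, smul_mul_smul_comm, ← map_mul (algebraMap k[X] (RatFunc k)),
        ← pow_add]
    obtain ⟨y, hy⟩ := hbound _ _ _ e hγγ
    obtain ⟨r, hr⟩ := hg y (hmem _ y hy hγγ)
    refine ⟨r, ?_⟩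
    have e2 : g * g = g * (QuaternionAlgebra.coe (f ^ N) * r) := by
      apply toD_injective
      rw [← mul_assoc, ← QuaternionAlgebra.coe_commutes, mul_assoc, map_mul (toD b c) _ (g * r),
        ← hr, hy, ← e, toD_coe, ← Algebra.smul_def, smul_smul, ← map_mul, pow_add]
    have e3 := PolyOrder.mul_left_cancel han hg0 e2
    rw [hγ, e3, map_mul, toD_coe, ← Algebra.smul_def, smul_smul, inv_mul_cancel₀ (hf0 N), one_smul]
  obtain ⟨y, hy⟩ := hbound x m h hx hst
  obtain ⟨r, hr⟩ := hg y (hmem x y hy hst)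
  refine ⟨w * r, ?_⟩
  have : algebraMap k[X] (RatFunc k) (f ^ N) • toD b c (w * r) =
      algebraMap k[X] (RatFunc k) (f ^ N) • x := by
    rw [← hy, hr, map_mul, map_mul, ← hγg, hw, smul_mul_assoc]
  have h3 := congrArg ((algebraMap k[X] (RatFunc k) (f ^ N))⁻¹ • ·) this
  simpa only [smul_smul, inv_mul_cancel₀ (hf0 N), one_smul] using h3

end Localisation

/-! ### Scalar units -/

section Scalars

variable {k : Type*} [Field k] {b c : k} {S : Finset (Place k)}

/-- The first coordinates of w and w⁻¹ are S-integers inverse to each other. Hence proportionality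
over K suffices for equality in Λ_S. -/
theorem mem_scalarUnits {w : (orderSections b c S)ˣ} {μ : RatFunc k}
    (hw : w.1.1 = algebraMap (RatFunc k) (D b c) μ) : w ∈ scalarUnits b c S := by
  have h1 : μ * (w⁻¹).1.1.re = 1 := by
    have h : w.1.1 * (w⁻¹).1.1 = 1 := congrArg Subtype.val w.mul_inv
    rw [hw, ← Algebra.smul_def] at h
    exact congrArg QuaternionAlgebra.re h
  have hμ : μ ∈ sIntegers S := by
    have h := w.1.2.1
    rw [hw] at h
    exact h
  let u : (sIntegers S)ˣ := ⟨⟨μ, hμ⟩, ⟨_, (w⁻¹).1.2.1⟩, Subtype.ext h1,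
    Subtype.ext ((mul_comm _ _).trans h1)⟩
  exact ⟨u, Units.ext (Subtype.ext hw.symm)⟩

theorem mk_eq_mk_iff {g h : (orderSections b c S)ˣ} :
    (g : Lambda b c S) = h ↔ ∃ μ : RatFunc k, h.1.1 = μ • g.1.1 := by
  rw [QuotientGroup.eq]
  constructor
  · rintro ⟨u, hu⟩
    refine ⟨u.1.1, ?_⟩
    have h1 : h = g * Units.map (scalarHom b c S).toMonoidHom u := by rw [hu, mul_inv_cancel_left]
    rw [h1, Algebra.smul_def, Algebra.commutes]
    rfl
  · rintro ⟨μ, hμ⟩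
    refine mem_scalarUnits (μ := μ) ?_
    have h1 : (g⁻¹).1.1 * g.1.1 = 1 := congrArg Subtype.val g.inv_mul
    change (g⁻¹).1.1 * h.1.1 = _
    rw [hμ, mul_smul_comm, h1, Algebra.algebraMap_eq_smul_one]

end Scalars

/-! ### Representatives of the stabiliser -/

section StabilizerReps

variable {k : Type*} [Field k] {b c : k} {S : Finset (Place k)}

/-- Homogeneous coordinates of the points of the projective line over `k`. -/
def projCoord : Option k → k × k
  | none => (1, 0)
  | some a => (a, 1)

theorem projCoord_ne_zero (p : Option k) : (projCoord p).1 ≠ 0 ∨ (projCoord p).2 ≠ 0 := by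
  cases p <;> simp [projCoord]

theorem exists_projCoord (x y : k) :
    ∃ (e : k) (p : Option k), x = e * (projCoord p).1 ∧ y = e * (projCoord p).2 := by
  by_cases hy : y = 0
  · exact ⟨x, none, by simp [projCoord], by simp [projCoord, hy]⟩
  · exact ⟨y, some (x / y), by simp [projCoord, mul_div_cancel₀ _ hy], by simp [projCoord]⟩

variable (b c) in
/-- Representatives of the elements of the stabiliser: `x + yZ` and `(x + yZ)F`, with `(x : y)` a
point of the projective line over `k`. -/
def stabRep (p : Option k × Bool) : PolyOrder b c :=
  if p.2 then ⟨0, 0, C (projCoord p.1).1, C (projCoord p.1).2⟩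
  else ⟨C (projCoord p.1).1, C (projCoord p.1).2, 0, 0⟩

/-- The positions of the zero coordinates separate the cases; when they agree, a coordinate
normalised to 1 forces μ = 1. -/
theorem stabRep_injective {p p' : Option k × Bool} {μ : RatFunc k}
    (h : toD b c (stabRep b c p') = μ • toD b c (stabRep b c p)) : p = p' := by
  obtain ⟨p, i⟩ := p
  obtain ⟨p', i'⟩ := p'
  have h0 := congrArg QuaternionAlgebra.re h
  have h1 := congrArg QuaternionAlgebra.imI h
  have h2 := congrArg QuaternionAlgebra.imJ h
  have h3 := congrArg QuaternionAlgebra.imK h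
  have key : ∀ a a' : k, (RatFunc.C a' : RatFunc k) = μ * RatFunc.C a → 1 = μ → a = a' := by
    rintro a a' h rfl
    rw [one_mul] at h
    exact (RatFunc.C_injective h).symm
  cases p <;> cases p' <;> cases i <;> cases i' <;>
    simp [stabRep, projCoord, toD] at h0 h1 h2 h3 ⊢
  all_goals first
    | exact key _ _ h0 h1
    | exact key _ _ h2 h3
    | simp [← h1] at h0
    | simp [← h3] at h2

variable (han : ∀ x y : k, quadNorm b c x y = 0 → x = 0 ∧ y = 0)
include han

theorem reducedNorm_stabRep (p : Option k × Bool) :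
    ∃ (a : k) (j : ℕ), a ≠ 0 ∧ reducedNorm (stabRep b c p) = C a * X ^ j := by
  have hN : quadNorm b c (projCoord p.1).1 (projCoord p.1).2 ≠ 0 := fun h =>
    (projCoord_ne_zero p.1).elim (· (han _ _ h).1) (· (han _ _ h).2)
  obtain ⟨p, i⟩ := p
  cases i
  · exact ⟨_, 0, hN, by simp [stabRep, reducedNorm, quadNorm]⟩
  · exact ⟨_, 1, neg_ne_zero.2 hN, by simp [stabRep, reducedNorm, quadNorm]; ring⟩

theorem reducedNorm_stabRep_not_mem (p : Option k × Bool) {w : HeightOneSpectrum k[X]}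
    (hw : Place.finite w ≠ Place.zero k) : reducedNorm (stabRep b c p) ∉ w.asIdeal := by
  obtain ⟨a, j, ha, h⟩ := reducedNorm_stabRep han p
  rw [h]
  intro hmem
  rcases w.isPrime.mem_or_mem hmem with h1 | h1
  · exact C_not_mem ha h1
  · exact X_not_mem hw (w.isPrime.mem_of_pow_mem j h1)

theorem reducedNorm_stabRep_ne_zero (p : Option k × Bool) : reducedNorm (stabRep b c p) ≠ 0 := by
  obtain ⟨a, j, ha, h⟩ := reducedNorm_stabRep han p
  rw [h]
  exact mul_ne_zero (C_ne_zero.2 ha) (pow_ne_zero _ X_ne_zero)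

/-- The representatives as units of the ring of sections. -/
def stabUnit (h0 : Place.zero k ∈ S) (hinf : Place.infinity ∈ S) (p : Option k × Bool) :
    (orderSections b c S)ˣ :=
  sectionUnit hinf (x := stabRep b c p) (y := star (stabRep b c p))
    (reducedNorm_stabRep_ne_zero han p)
    (fun _ hw => reducedNorm_stabRep_not_mem han p fun h => hw (h ▸ h0))
    (PolyOrder.mul_comm_of_mul_eq_coe han (reducedNorm_stabRep_ne_zero han p)
      (star_mul_self_eq_reducedNorm _))
    (star_mul_self_eq_reducedNorm _)

omit han in
-- Since F² = t is central, only the parity of j matters modulo scalars.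
theorem quaternion_j_pow (j : ℕ) : ∃ (m : ℕ) (i : Bool), ∀ x y : k,
    (⟨C x, C y, 0, 0⟩ * (⟨0, 0, 1, 0⟩ : PolyOrder b c) ^ j : PolyOrder b c) =
      QuaternionAlgebra.coe (X ^ m) * (if i then ⟨0, 0, C x, C y⟩ else ⟨C x, C y, 0, 0⟩) := by
  have hsq : (⟨0, 0, 1, 0⟩ : PolyOrder b c) ^ 2 = QuaternionAlgebra.coe X := by
    rw [pow_two, QuaternionAlgebra.mk_mul_mk]
    ext : 1 <;> simp
  have hpow : ∀ m : ℕ, (⟨0, 0, 1, 0⟩ : PolyOrder b c) ^ (2 * m) =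
      QuaternionAlgebra.coe (X ^ m) := fun m => by
    rw [pow_mul, hsq]
    exact (map_pow (algebraMap k[X] (PolyOrder b c)) X m).symm
  rcases Nat.even_or_odd' j with ⟨m, rfl | rfl⟩
  · refine ⟨m, false, fun x y => ?_⟩
    rw [hpow, QuaternionAlgebra.coe_commutes]
    rfl
  · refine ⟨m, true, fun x y => ?_⟩
    rw [pow_succ, hpow, ← mul_assoc,
      ← QuaternionAlgebra.coe_commutes (X ^ m) (⟨C x, C y, 0, 0⟩ : PolyOrder b c), mul_assoc]
    refine congrArg (QuaternionAlgebra.coe (X ^ m) * ·) ?_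
    rw [QuaternionAlgebra.mk_mul_mk, if_pos rfl]
    ext : 1 <;> simp

/-- Divisors of powers of `X` in the polynomial order are proportional to representatives. -/
theorem exists_eq_stabRep {h h' : PolyOrder b c} {n : ℕ}
    (hh : h * h' = QuaternionAlgebra.coe (X ^ n)) :
    ∃ (d : k[X]) (p : Option k × Bool),
      h = QuaternionAlgebra.coe d * stabRep b c p := by
  -- By multiplicativity nr(h) divides t^(2n), so it is a nonzero constant times a power of t.
  have hdvd : reducedNorm h ∣ X ^ (n * 2) := ⟨reducedNorm h', by
    rw [← reducedNorm_mul, hh, reducedNorm_coe, pow_mul]⟩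
  obtain ⟨j, -, u, hu⟩ := (dvd_prime_pow prime_X _).1 hdvd
  obtain ⟨a, ha, hau⟩ := Polynomial.isUnit_iff.1 (u⁻¹).isUnit
  have hn : reducedNorm h = C a * X ^ j := by
    rw [hau, ← hu, mul_comm, mul_assoc, Units.mul_inv, mul_one]
  obtain ⟨x, y, hx⟩ := PolyOrder.eq_const_mul_pow han j h a ha.ne_zero hn
  obtain ⟨m, i, hm⟩ := quaternion_j_pow (b := b) (c := c) j
  obtain ⟨e, p, h1, h2⟩ := exists_projCoord x y
  refine ⟨X ^ m * C e, (p, i), ?_⟩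
  rw [hx, hm, QuaternionAlgebra.coe_mul, mul_assoc, h1, h2]
  congr 1
  cases i <;> (rw [QuaternionAlgebra.coe_mul_eq_smul]; ext : 1) <;> simp [stabRep]

end StabilizerReps

/-! ### The orbit and the stabiliser of the standard vertex -/

section Action

open Filter

variable {k : Type*} [Field k] {b c : k} {S : Finset (Place k)} (φ : Splitting b c S)

/-- The vertex given by the standard lattices. -/
def baseVertex : ProductVertex φ := fun v =>
  Quotient.mk _ ⟨localLattice φ v, isLattice_localLattice φ v⟩

theorem smul_baseVertex_eq_iff (g : (orderSections b c S)ˣ)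
    (L : ∀ v : UnramifiedPlace S, Lattice (CompletionIntegers v.1) (Completion v.1)) :
    ((g : Lambda b c S) • baseVertex φ = fun v => Quotient.mk _ (L v)) ↔
      ∀ v, ∃ u : (Completion v.1)ˣ,
        translate (scalarGL u).1 (translate (localRep φ v g.1.1) (localLattice φ v)) = (L v).1 := by
  constructor
  · intro h v
    obtain ⟨u, hu⟩ := Quotient.exact (congrFun h v)
    exact ⟨u, congrArg Subtype.val hu⟩
  · intro h
    funext v
    obtain ⟨u, hu⟩ := h v
    exact Quotient.sound ⟨u, Subtype.ext hu⟩

theorem localRep_mul_inv (v : UnramifiedPlace S) (g : (orderSections b c S)ˣ) :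
    localRep φ v g.1.1 * localRep φ v (g⁻¹).1.1 = 1 := by
  rw [← map_mul, show g.1.1 * (g⁻¹).1.1 = 1 from congrArg Subtype.val g.mul_inv, map_one]

variable (han : ∀ x y : k, quadNorm b c x y = 0 → x = 0 ∧ y = 0)
include han

theorem exists_smul_baseVertex_eq (hinf : Place.infinity ∈ S) (P : ProductVertex φ) :
    ∃ g : Lambda b c S, g • baseVertex φ = P := by
  obtain ⟨f, hf⟩ := exists_isSupportedOn S
  choose L hL using fun v => Quotient.exists_rep (P v)
  obtain ⟨u, x, hx⟩ := exists_translate_eq_scalar φ (fun v => (L v).1) fun v => (L v).2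
  obtain ⟨n, g, r, hgr, hg⟩ := exists_unit_translate_eq φ han hf x _
    (fun v => isLattice_translate (scalarGL (u v)) _ (L v).2) hx
  have hn : f ^ n ≠ 0 := pow_ne_zero n hf.1
  refine ⟨(sectionUnit hinf hn (fun w hw => hf.not_mem hw n) hgr
    (PolyOrder.mul_comm_of_mul_eq_coe han hn hgr) : (orderSections b c S)ˣ), ?_⟩
  rw [show P = fun v => Quotient.mk _ (L v) from funext fun v => (hL v).symm,
    smul_baseVertex_eq_iff]
  refine fun v => ⟨(u v)⁻¹, ?_⟩
  refine (congrArg (translate _) (hg v)).trans ?_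
  rw [← translate_mul, ← Units.val_mul, ← map_mul, inv_mul_cancel, map_one, Units.val_one,
    translate_one]

theorem stabUnit_mem_stabilizer (h0 : Place.zero k ∈ S) (hinf : Place.infinity ∈ S)
    (p : Option k × Bool) :
    (stabUnit han h0 hinf p : Lambda b c S) ∈ MulAction.stabilizer (Lambda b c S) (baseVertex φ) := by
  rw [MulAction.mem_stabilizer_iff]
  refine (smul_baseVertex_eq_iff φ _ _).2 fun v => ⟨1, ?_⟩
  rw [map_one, Units.val_one, translate_one]
  refine le_antisymm (translate_toD_le φ v _) ?_
  -- The inverse is the conjugate divided by the norm, and the norm is a unit at v; so the inverse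
  -- preserves the lattice too.
  have hinv : translate (localRep φ v ((stabUnit han h0 hinf p)⁻¹).1.1) (localLattice φ v) ≤
      localLattice φ v := by
    refine translate_localRep_le φ fun i => ?_
    change v.1.valuation (RatFunc k) (coord (_ • toD b c _) i) ≤ 1
    rw [coord_smul, smul_eq_mul, map_mul, map_inv₀,
      valuation_eq_one_of_not_mem (reducedNorm_stabRep_not_mem han p v.2.2), inv_one, one_mul,
      coord_toD]
    exact v.1.valuation_le_one _
  have h := Submodule.map_mono (f := (Matrix.toLin' (localRep φ v
    (stabUnit han h0 hinf p).1.1)).restrictScalars (CompletionIntegers v.1)) hinv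
  change translate _ (translate _ _) ≤ translate _ _ at h
  rwa [← translate_mul, localRep_mul_inv, translate_one] at h

/-- Sections stabilising the standard lattices become polynomial after multiplication by a power
of `X`. -/
theorem exists_toD_eq_X_pow_smul {x : D b c} (hx : x ∈ orderSections b c S)
    (hinf : Place.infinity ∈ S)
    (hst : ∀ v, translate (localRep φ v x) (localLattice φ v) ≤ localLattice φ v) :
    ∃ (n : ℕ) (h : PolyOrder b c), toD b c h = algebraMap k[X] (RatFunc k) (X ^ n) • x := by
  obtain ⟨f, hf⟩ := exists_isSupportedOn S
  obtain ⟨n, hn⟩ := (eventually_all.2 fun i =>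
    hf.eventually_isPoly ((mem_orderSections_iff hinf).1 hx i)).exists
  obtain ⟨h, hh⟩ := exists_toD_eq (x := algebraMap k[X] (RatFunc k) ((X * f) ^ n) • x)
    fun i => by rw [coord_smul]; exact hn i
  -- (Xf)^n clears all denominators. As X^n x still preserves the lattices, the factor f^n is
  -- superfluous.
  refine ⟨n, exists_toD_eq_of_translate_le φ han hf (m := n) (h := h) ?_ fun v => ?_⟩
  · rw [hh, smul_smul, ← map_mul, ← mul_pow, mul_comm f]
  · rw [Algebra.smul_def, ← toD_coe, map_mul, translate_mul]
    exact (Submodule.map_mono (hst v)).trans (translate_toD_le φ v _)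

omit han in
-- The scalars u and s differ by a unit of O, so u may be replaced by s, for A and for its inverse.
theorem translate_smul_le {O K : Type*} [CommRing O] [Field K] [Algebra O K]
    {L : Submodule O (Fin 2 → K)} {A A' : Matrix (Fin 2) (Fin 2) K} (hA : A' * A = 1)
    {u s : K} {ε ε' : O} (hε : s = u * algebraMap O K ε) (hs : s ≠ 0)
    (hε' : u = s * algebraMap O K ε') (hL : translate (u • A) L = L) :
    translate (s • A) L ≤ L ∧ translate (s⁻¹ • A') L ≤ L := by
  constructor
  · refine translate_le.2 fun m hm => ?_
    rw [hε, mul_comm, mul_smul, Matrix.smul_mulVec, algebraMap_smul]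
    exact L.smul_mem _ (translate_le.1 hL.le m hm)
  · refine translate_le.2 fun m hm => ?_
    rw [← hL] at hm
    obtain ⟨m', hm', rfl⟩ := mem_translate.1 hm
    rw [Matrix.mulVec_mulVec, Matrix.smul_mul, Matrix.mul_smul, hA, smul_smul, Matrix.smul_mulVec,
      Matrix.one_mulVec, hε', inv_mul_cancel_left₀ hs, algebraMap_smul]
    exact L.smul_mem _ hm'

theorem exists_stabUnit_of_mem_stabilizer (h0 : Place.zero k ∈ S) (hinf : Place.infinity ∈ S)
    {g : Lambda b c S} (hg : g ∈ MulAction.stabilizer (Lambda b c S) (baseVertex φ)) :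
    ∃ p, (stabUnit han h0 hinf p : Lambda b c S) = g := by
  obtain ⟨g, rfl⟩ := QuotientGroup.mk_surjective g
  rw [MulAction.mem_stabilizer_iff] at hg
  choose u hu using (smul_baseVertex_eq_iff φ g _).1 hg
  -- A global S-unit s with the valuations of the local homothety factors makes both sg and (sg)⁻¹
  -- preserve the lattices. Up to powers of t both lie in H, so their product there is a power of t.
  obtain ⟨s, hs, hs', hsu⟩ := exists_sUnit hinf u
  have hst : ∀ v, translate (localRep φ v ((s : RatFunc k) • g.1.1)) (localLattice φ v) ≤
      localLattice φ v ∧ translate (localRep φ v ((s : RatFunc k)⁻¹ • (g⁻¹).1.1))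
        (localLattice φ v) ≤ localLattice φ v := by
    intro v
    have hs0 : algebraMap (RatFunc k) (Completion v.1) s ≠ 0 := by simp
    have hval : Valued.v (algebraMap (RatFunc k) (Completion v.1) s) =
      Valued.v (u v : Completion v.1) := by rw [valued_algebraMap, hsu]
    obtain ⟨ε, hε⟩ := exists_mul_of_valued_le (u v).ne_zero hval.le
    obtain ⟨ε', hε'⟩ := exists_mul_of_valued_le hs0 hval.ge
    have hinv : localRep φ v (g⁻¹).1.1 * localRep φ v g.1.1 = 1 := by
      simpa using localRep_mul_inv φ v g⁻¹
    have h := hu v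
    rw [translate_scalarGL] at h
    rw [localRep_smul, localRep_smul, map_inv₀]
    exact translate_smul_le hinv hε hs0 hε' h
  obtain ⟨n, h, hh⟩ := exists_toD_eq_X_pow_smul φ han (smul_mem_orderSections hs g.1.2) hinf
    fun v => (hst v).1
  obtain ⟨m, h', hh'⟩ := exists_toD_eq_X_pow_smul φ han
    (smul_mem_orderSections (by simpa using hs') (g⁻¹).1.2) hinf fun v => (hst v).2
  have hmul : h * h' = QuaternionAlgebra.coe (X ^ (n + m)) := by
    apply toD_injective
    rw [map_mul, hh, hh', toD_coe, smul_mul_smul_comm, smul_mul_smul_comm,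
      show g.1.1 * (g⁻¹).1.1 = 1 from congrArg Subtype.val g.mul_inv, ← map_mul, ← pow_add,
      mul_inv_cancel₀ s.ne_zero, one_smul, Algebra.algebraMap_eq_smul_one (A := D b c)]
  obtain ⟨d, p, hp⟩ := exists_eq_stabRep han hmul
  refine ⟨p, mk_eq_mk_iff.2 ⟨(algebraMap k[X] (RatFunc k) (X ^ n) * s)⁻¹ *
    algebraMap k[X] (RatFunc k) d, ?_⟩⟩
  have hX : algebraMap k[X] (RatFunc k) (X ^ n) * s ≠ 0 := mul_ne_zero
    ((map_ne_zero_iff _ (IsFractionRing.injective k[X] (RatFunc k))).2 (pow_ne_zero n X_ne_zero))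
    s.ne_zero
  change g.1.1 = _ • toD b c (stabRep b c p)
  rw [mul_smul, Algebra.smul_def (algebraMap k[X] (RatFunc k) d), ← toD_coe, ← map_mul, ← hp, hh,
    smul_smul (algebraMap k[X] (RatFunc k) (X ^ n)), smul_smul, inv_mul_cancel₀ hX, one_smul]

/-- The stabiliser of the standard vertex. -/
def stabilizerEquiv (h0 : Place.zero k ∈ S) (hinf : Place.infinity ∈ S) :
    Option k × Bool ≃ MulAction.stabilizer (Lambda b c S) (baseVertex φ) :=
  Equiv.ofBijective (fun p => ⟨_, stabUnit_mem_stabilizer φ han h0 hinf p⟩) ⟨fun p p' h => by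
    obtain ⟨μ, hμ⟩ := mk_eq_mk_iff.1 (congrArg Subtype.val h)
    exact stabRep_injective hμ, fun g => by
    obtain ⟨p, hp⟩ := exists_stabUnit_of_mem_stabilizer φ han h0 hinf g.2
    exact ⟨p, Subtype.ext hp⟩⟩

end Action

/-! ### Orbifold degree of a transitive action -/

section Orbifold

variable {G X : Type*} [Group G] [MulAction G X]

theorem nonempty_stabilizer_equiv {x : X} (hx : ∀ y, ∃ g : G, g • x = y) (y : X) :
    Nonempty (MulAction.stabilizer G y ≃ MulAction.stabilizer G x) :=
  ⟨(MulAction.stabilizerEquivStabilizerOfOrbitRel (hx y)).toEquiv⟩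

theorem subsingleton_orbits {x : X} (hx : ∀ y, ∃ g : G, g • x = y) :
    Subsingleton (MulAction.orbitRel.Quotient G X) := by
  have h : ∀ z : MulAction.orbitRel.Quotient G X, z = Quotient.mk _ x := fun z => by
    obtain ⟨y, rfl⟩ := Quotient.exists_rep z
    exact Quotient.sound (hx y)
  exact ⟨fun z w => (h z).trans (h w).symm⟩

/-- The orbifold degree of a transitive action. -/
theorem orbifoldDegree_eq_of_transitive {x : X} (hx : ∀ y, ∃ g : G, g • x = y) :
    orbifoldDegree G X = ((ENat.card (MulAction.stabilizer G x) : ℕ∞) : ℝ≥0∞)⁻¹ := by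
  have := subsingleton_orbits hx
  rw [orbifoldDegree, tsum_eq_single (Quotient.mk _ x) fun z hz => absurd (Subsingleton.elim _ _) hz]
  obtain ⟨e⟩ := nonempty_stabilizer_equiv hx
    (Quotient.mk (MulAction.orbitRel G X) x : MulAction.orbitRel.Quotient G X).out
  rw [ENat.card_congr e]

end Orbifold

end QuatLattice

end

theorem proposition2p5 (k : Type*) [Field k] [Fintype k] (b c : k)
    (hbc : QuatLattice.IsAdmissible b c)
    (S : Finset (QuatLattice.Place k))
    (h0 : QuatLattice.Place.zero k ∈ S) (hinf : QuatLattice.Place.infinity ∈ S) :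
    Nonempty (QuatLattice.Splitting b c S) ∧
    ∀ φ : QuatLattice.Splitting b c S,
      Finite (MulAction.orbitRel.Quotient (QuatLattice.Lambda b c S)
        (QuatLattice.ProductVertex φ)) ∧
      (∀ P : QuatLattice.ProductVertex φ,
        Finite (MulAction.stabilizer (QuatLattice.Lambda b c S) P)) ∧
      QuatLattice.orbifoldDegree (QuatLattice.Lambda b c S) (QuatLattice.ProductVertex φ)
        = 1 / (2 * ((Fintype.card k : ENNReal) + 1)) := by
  refine ⟨hbc.nonempty_splitting S, fun φ => ?_⟩
  have han : ∀ x y : k, QuatLattice.quadNorm b c x y = 0 → x = 0 ∧ y = 0 :=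
    fun _ _ h => hbc.quadNorm_eq_zero h
  have htrans := QuatLattice.exists_smul_baseVertex_eq φ han hinf
  let e := QuatLattice.stabilizerEquiv φ han h0 hinf
  have := QuatLattice.subsingleton_orbits htrans
  refine ⟨inferInstance, fun P => ?_, ?_⟩
  · obtain ⟨e'⟩ := QuatLattice.nonempty_stabilizer_equiv htrans P
    exact Finite.of_equiv _ (e.trans e'.symm)
  -- `Option k × Bool` has (q + 1) · 2 elements.
  · rw [QuatLattice.orbifoldDegree_eq_of_transitive htrans, ← ENat.card_congr e, one_div]
    simp [mul_comm]
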